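/- Let $F$ be a totally real number field of degree $d$ with ring of integers $\mathcal{O}_F$ and real embeddings $\sigma_1,\dots,\sigma_d$. For $a\in F$ write $a^{\sigma_j}=\sigma_j(a)$, and for a vector apply this coordinatewise. For $a\in\mathcal{O}_F$ write $N(a)=|N_{F/\mathbb{Q}}(a)|$ and $|a|_\infty=\max_j|a^{\sigma_j}|$, and for $\eta\in\mathbb{R}^d$ write $N(\eta)=\prod_j|\eta_j|$. An integral quadratic form in $n$ variables is $Q(\mathbf{x})=\tfrac12\sum_{i,j}a_{ij}x_ix_j$ with $a_{ij}=a_{ji}\in\mathcal{O}_F$ and $a_{jj}\in2\mathcal{O}_F$. Its discriminant is $\Delta=\det(a_{ij})$. Write $Q^{\sigma}(\mathbf{x})=\tfrac12\sum_{i,j}a_{ij}^{\sigma}x_ix_j$ and $\langle\mathbf{x},\mathbf{y}\rangle=\tfrac12\sum_{i,j}a_{ij}^{\sigma}x_iy_j$ for the conjugated form and its bilinear form at a real embedding $\sigma$. The form is totally positive definite if every $Q^{\sigma}$ is positive definite. For $M\in\mathbb{R}$ the form is called reduced with constant $M$ if there are $h_i,c_{ij}\in F$ with $$Q(\mathbf{x})=\sum_{i=1}^n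 h_i\Bigl(x_i+\sum_{j>i}c_{ij}x_j\Bigr)^2$$ such that $|a_{ij}^{\sigma}|\le Ma_{jj}^{\sigma}$, $a_{jj}^{\sigma}\le Mh_j^{\sigma}$, $h_j^{\sigma}\le Ma_{jj}^{\sigma}$ and $1\le Mh_j^{\sigma}$ for all $i,j$ and all $\sigma$, and $h_i^{\sigma}\le Mh_j^{\tau}$ for all $i\le j$ and all $\sigma,\tau$. Let $M\in\mathbb{R}$ and $\varepsilon>0$. There is a constant $C>0$, depending only on $F$, $M$ and $\varepsilon$, with the following property. Let $Q(\mathbf{y})=y_0^2+\tilde Q(\tilde{\mathbf{y}})$, with $\tilde{\mathbf{y}}=(y_1,y_2,y_3)^t$, be an integral totally positive definite quaternary quadratic form over $\mathcal{O}_F$ of discriminant $\Delta$ such that $\tilde Q$ is reduced with constant $M$. Let $\ell\in\mathcal{O}_F\setminus\{0\}$ be totally positive, let $\eta=(\eta_1,\dots,\eta_d)\in(0,1]^d$, and let $\mathbf{x}_1,\dots,\mathbf{x}_d\in\mathbb{R}^3$ satisfy $\tilde Q^{\sigma_j}(\mathbf{x}_j)=1$ for all $j$. Below, $\langle\cdot,\cdot\rangle$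 is the bilinear form of $\tilde Q^{\sigma_j}$, and the inequalities in the sets are required for all $j=1,\dots,d$. Then both sets below are finite, and $$\#\bigl\{\mathbf{y}\in\mathcal{O}_F^4 : Q(\mathbf{y})=\ell,\ (y_0^{\sigma_j})^2+\langle\tilde{\mathbf{y}}^{\sigma_j},\mathbf{x}_j\rangle^2\le\eta_j\ell^{\sigma_j}\bigr\}$$ $$\le C\Bigl(N(\eta)^{1/2}N(\ell)+1+\min\bigl(N(\ell)^{3/2}N(\eta)^{1/2},\,N(\ell)^{1/2}\bigr)\Bigr)\bigl(|\ell|_\infty N(\Delta)\bigr)^{\varepsilon}$$ and $$\#\bigl\{\mathbf{y}\in\mathcal{O}_F^4 : Q(\mathbf{y})=\ell,\ \tilde Q^{\sigma_j}(\tilde{\mathbf{y}}^{\sigma_j})-\langle\tilde{\mathbf{y}}^{\sigma_j},\mathbf{x}_j\rangle^2\le\eta_j\ell^{\sigma_j}\bigr\}$$ $$\le C\Bigl(1+\min\bigl(N(\eta)^{3/11}N(\ell)^{12/11},\,N(\ell)\bigr)\Bigr)\bigl(|\ell|_\infty N(\Delta)\bigr)^{\varepsilon}.$$ -/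

import Mathlib

open NumberField

noncomputable section

namespace QuatCount

/-- The symmetric matrix `A = (a_ij)` over `𝓞 F` attached to an integral quadratic form `Q` on
`(𝓞 F)^n`, i.e. `a_ij = Q (e_i + e_j) - Q e_i - Q e_j`. In particular `a_jj = 2 Q e_j` and
`Q x = (1/2) ∑ a_ij x_i x_j`. -/
def gramMatrix {F : Type*} [Field F] {n : ℕ} (Q : QuadraticForm (𝓞 F) (Fin n → 𝓞 F)) :
    Matrix (Fin n) (Fin n) (𝓞 F) :=
  Matrix.of fun i j => QuadraticMap.polar Q (Pi.single i 1) (Pi.single j 1)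

/-- The discriminant (determinant) `Δ = det A` of an integral quadratic form. -/
def disc {F : Type*} [Field F] {n : ℕ} (Q : QuadraticForm (𝓞 F) (Fin n → 𝓞 F)) : 𝓞 F :=
  (gramMatrix Q).det

/-- The bilinear form `⟨x, y⟩ = (1/2) xᵗ A y` attached to `Q`, with coefficients conjugated by
an embedding `σ : F → K` and variables in `K`. -/
def bil {F K : Type*} [Field F] [Field K] {n : ℕ} (Q : QuadraticForm (𝓞 F) (Fin n → 𝓞 F))
    (σ : F →+* K) (x y : Fin n → K) : K :=
  (1 / 2) * ∑ i, ∑ j, σ (gramMatrix Q i j : F) * x i * y j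

/-- The conjugated form `Q^σ(x) = (1/2) xᵗ A^σ x`, for an embedding `σ : F → K` and variables
in `K`. -/
def conj {F K : Type*} [Field F] [Field K] {n : ℕ} (Q : QuadraticForm (𝓞 F) (Fin n → 𝓞 F))
    (σ : F →+* K) (x : Fin n → K) : K :=
  bil Q σ x x

/-- `Q^σ` is positive definite for every real embedding `σ`. -/
def TotPosDef {F : Type*} [Field F] {n : ℕ} (Q : QuadraticForm (𝓞 F) (Fin n → 𝓞 F)) : Prop :=
  ∀ σ : F →+* ℝ, ∀ x : Fin n → ℝ, x ≠ 0 → 0 < conj Q σ x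

/-- `Q` is reduced (Humbert), all implied constants being at most `M`:
`Q = h_1 (x_1 + c_12 x_2 + ...)^2 + h_2 (x_2 + c_23 x_3 + ...)^2 + ... + h_n x_n^2` over `F`,
with `a_ij^σ ≪ a_jj^σ ≍ h_j^σ` for all `i, j, σ`, and
`1 ≪ h_1^{σ_1} ≍ ... ≍ h_1^{σ_d} ≪ h_2^{σ_1} ≍ ... ≍ h_2^{σ_d} ≪ ... ≪ h_n^{σ_1} ≍ ...`. -/
def IsReduced {F : Type*} [Field F] {n : ℕ} (M : ℝ) (Q : QuadraticForm (𝓞 F) (Fin n → 𝓞 F)) :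
    Prop :=
  ∃ (h : Fin n → F) (c : Fin n → Fin n → F),
    (∀ x : Fin n → F, conj Q (RingHom.id F) x =
      ∑ i, h i * (x i + ∑ j ∈ Finset.Ioi i, c i j * x j) ^ 2) ∧
    (∀ (σ : F →+* ℝ) (i j : Fin n),
      |σ (gramMatrix Q i j : F)| ≤ M * σ (gramMatrix Q j j : F)) ∧
    (∀ (σ : F →+* ℝ) (j : Fin n),
      σ (gramMatrix Q j j : F) ≤ M * σ (h j) ∧ σ (h j) ≤ M * σ (gramMatrix Q j j : F)) ∧
    (∀ (σ : F →+* ℝ) (j : Fin n), 1 ≤ M * σ (h j)) ∧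
    (∀ (σ τ : F →+* ℝ) (i j : Fin n), i ≤ j → σ (h i) ≤ M * τ (h j))

/-- The (positive) norm `N(a) = |N_{F/ℚ}(a)|` of an algebraic integer, as a real number. -/
def nrm {F : Type*} [Field F] (a : 𝓞 F) : ℝ :=
  |((Algebra.norm ℤ a : ℤ) : ℝ)|

/-- The extension `η ↦ ∏_σ |η_σ|` of the norm to real vectors indexed by the real embeddings. -/
def nrmVec {F : Type*} [Field F] [NumberField F] (η : (F →+* ℝ) → ℝ) : ℝ :=
  ∏ σ, |η σ|

/-- `|a|_∞ = max_σ |a^σ|`. -/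
def supAbs {F : Type*} [Field F] (a : 𝓞 F) : ℝ :=
  ⨆ σ : F →+* ℝ, |σ (a : F)|

/-- The vector `y^σ` of conjugates. -/
def vecConj {F : Type*} [Field F] {n : ℕ} (σ : F →+* ℝ) (y : Fin n → 𝓞 F) : Fin n → ℝ :=
  fun i => σ (y i : F)

end QuatCount

end

open NumberField

noncomputable section

namespace QuatCount

/-! ### Uniform divisor bound for ideals -/

section DivisorBound

/-! Put `a = N(ℓ)^(1/2)` and `h = N(η)^(1/2)`. Up to a factor `N(ℓ)^ε`, each of the two sets
satisfies both a strip bound `a + h a²` and a plane bound `1 + h a³`; the theorem follows by taking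
the better one and comparing exponents.

The arithmetic input is `exists_card_coplanar_le`: an affine plane carries only `O(N(ℓ)^ε)` points
of the quadric `Q = ℓ`, uniformly in `Q`. Pairing a point with two independent directions `p, q` of
the plane turns the section into a norm equation `u² + D v² = k`, where `D` is a totally positive
Gram determinant and `N(k) ≪ N(ℓ)^4`. A solution generates an ideal of `F(√-D)` dividing `(k)`. The
divisor bound is uniform in fields of bounded degree, and solutions with the same ideal differ by
units whose traces lie in a fixed finite subset of `𝓞 F`, so `D` does not enter the constant.

Both bounds cut the points into cells lying in planes, and both rest on the fact that an integer
whose conjugates have product less than 1 vanishes (`eq_zero_of_prod_lt_one`).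

Strip bound (`card_le_of_strip`): two integral coordinates of the points lie in a strip with sides
about `√ℓ^σ` and `√(η_σ ℓ^σ)` at each place, so they take `≪ a + h a²` values, and fixing them
leaves a plane. Reducedness bounds the diagonal coefficients from below, so small differences in
diagonal coordinates force equal integers.

Plane bound (`exists_card_near_plane_le`): the points lie within `√(η_σ ℓ^σ)` of a real plane. After
cutting along one direction of that plane, the integral Gram determinants of differences inside a
cell have norm below 1, hence vanish, and `≪ 1 + h a³` cells suffice. If the required cells would be
thinner than the neighbourhood of the plane, the strip bound already gives this. -/

open UniqueFactorizationMonoid in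
/-- The number of prime ideals of bounded norm is bounded in terms of the degree of the field. -/
lemma card_primes_absNorm_le {L : Type*} [Field L] [NumberField L] {n N : ℕ}
    (hn : Module.finrank ℚ L ≤ n) (S : Finset (Ideal (𝓞 L)))
    (hS : ∀ P ∈ S, Prime P ∧ Ideal.absNorm P ≤ N) : S.card ≤ N.factorial * n := by
  have hne : Ideal.span {((N.factorial : ℕ) : 𝓞 L)} ≠ ⊥ := by
    rw [Ne, Ideal.span_singleton_eq_bot]
    exact_mod_cast N.factorial_ne_zero
  -- A prime contains its norm, hence `N!`; so distinct primes of norm at most `N` have a product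
  -- dividing `(N!)`, whose norm depends only on `N` and the degree.
  have hdvd : ∏ P ∈ S, P ∣ Ideal.span {((N.factorial : ℕ) : 𝓞 L)} := by
    refine Finset.prod_primes_dvd _ (fun P hP => (hS P hP).1) fun P hP => ?_
    rw [Ideal.dvd_span_singleton]
    have h0 : 0 < Ideal.absNorm P :=
      Nat.pos_of_ne_zero fun h => (hS P hP).1.ne_zero (Ideal.absNorm_eq_zero_iff.1 h)
    obtain ⟨m, hm⟩ := Nat.dvd_factorial h0 (hS P hP).2
    rw [hm, Nat.cast_mul]
    exact P.mul_mem_right _ P.absNorm_mem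
  have h1 : 2 ^ S.card ≤ Ideal.absNorm (∏ P ∈ S, P) := by
    rw [map_prod]
    refine Finset.pow_card_le_prod _ _ _ fun P hP => ?_
    have h0 : Ideal.absNorm P ≠ 0 :=
      fun h => (hS P hP).1.ne_zero (Ideal.absNorm_eq_zero_iff.1 h)
    have h1 : Ideal.absNorm P ≠ 1 := fun h =>
      (hS P hP).1.not_isUnit (Ideal.isUnit_iff.2 (Ideal.absNorm_eq_one_iff.1 h))
    omega
  have h2 : Ideal.absNorm (∏ P ∈ S, P) ≤ N.factorial ^ n := by
    have h3 := Ideal.absNorm_dvd_absNorm_of_le (Ideal.le_of_dvd hdvd)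
    have h4 : Ideal.absNorm (Ideal.span {((N.factorial : ℕ) : 𝓞 L)}) =
        N.factorial ^ Module.finrank ℚ L := by
      rw [Ideal.absNorm_span_singleton, show ((N.factorial : ℕ) : 𝓞 L) =
        algebraMap ℤ (𝓞 L) (N.factorial : ℤ) by simp, Algebra.norm_algebraMap, RingOfIntegers.rank]
      simp [Int.natAbs_pow]
    rw [h4] at h3
    exact (Nat.le_of_dvd (pow_pos N.factorial_pos _) h3).trans
      (Nat.pow_le_pow_right N.factorial_pos hn)
  have h5 : N.factorial ^ n ≤ 2 ^ (N.factorial * n) := by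
    rw [pow_mul]
    exact Nat.pow_le_pow_left Nat.lt_two_pow_self.le n
  exact (Nat.pow_le_pow_iff_right (by norm_num)).1 ((h1.trans h2).trans h5)

/-- From `exp t ≥ 1 + t`. This serves the prime ideals of small norm, each of which costs a constant
factor. -/
lemma nat_succ_le_mul_rpow {ε x : ℝ} (hε : 0 < ε) (hx : 2 ≤ x) (e : ℕ) :
    (e : ℝ) + 1 ≤ max 1 (1 / (ε * Real.log 2)) * (x ^ ε) ^ e := by
  have hl : 0 < Real.log 2 := Real.log_pos (by norm_num)
  have h1 : 1 + ε * Real.log 2 * e ≤ (x ^ ε) ^ e := by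
    have h2 : Real.exp (ε * Real.log 2 * e) ≤ (x ^ ε) ^ e := by
      rw [← Real.rpow_natCast, ← Real.rpow_mul (by linarith),
        Real.rpow_def_of_pos (by linarith), Real.exp_le_exp]
      have : Real.log 2 ≤ Real.log x := Real.log_le_log (by norm_num) hx
      calc ε * Real.log 2 * e = Real.log 2 * (ε * e) := by ring
        _ ≤ _ := by gcongr
    linarith [Real.add_one_le_exp (ε * Real.log 2 * e)]
  have h3 : (e : ℝ) + 1 ≤ max 1 (1 / (ε * Real.log 2)) * (1 + ε * Real.log 2 * e) := by
    have h4 : (e : ℝ) ≤ max 1 (1 / (ε * Real.log 2)) * (ε * Real.log 2 * e) := by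
      calc (e : ℝ) = 1 / (ε * Real.log 2) * (ε * Real.log 2 * e) := by field_simp
        _ ≤ _ := by gcongr; exact le_max_right _ _
    linarith [le_max_left 1 (1 / (ε * Real.log 2))]
  exact h3.trans (by gcongr)

/-- Once `x ^ ε ≥ 2`, the bound `e + 1 ≤ 2 ^ e` costs no constant, so only the boundedly many primes
of norm up to about `2 ^ (1 / ε)` affect the divisor bound. -/
lemma nat_succ_le_rpow {ε x : ℝ} (hε : 0 < ε) (hx : (2 : ℝ) ^ (1 / ε) ≤ x) (e : ℕ) :
    (e : ℝ) + 1 ≤ (x ^ ε) ^ e := by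
  have h1 : (2 : ℝ) ≤ x ^ ε := by
    calc (2 : ℝ) = ((2 : ℝ) ^ (1 / ε)) ^ ε := by
          rw [← Real.rpow_mul (by norm_num), one_div_mul_cancel hε.ne', Real.rpow_one]
      _ ≤ _ := by gcongr
  have h2 : (e : ℝ) + 1 ≤ 2 ^ e := by exact_mod_cast Nat.lt_two_pow_self
  exact h2.trans (by gcongr)

open UniqueFactorizationMonoid in
/-- The divisor bound for ideals, uniform over all number fields of bounded degree. -/
lemma exists_card_ideal_dvd_le (n : ℕ) {ε : ℝ} (hε : 0 < ε) :
    ∃ C : ℝ, 0 < C ∧ ∀ (L : Type*) [Field L] [NumberField L], Module.finrank ℚ L ≤ n →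
      ∀ J : Ideal (𝓞 L), J ≠ ⊥ → ∀ T : Finset (Ideal (𝓞 L)), (∀ I ∈ T, I ∣ J) →
        (T.card : ℝ) ≤ C * (Ideal.absNorm J : ℝ) ^ ε := by
  classical
  set C₁ : ℝ := max 1 (1 / (ε * Real.log 2)) with hC₁
  have hC₁1 : 1 ≤ C₁ := le_max_left _ _
  set N : ℕ := ⌈(2 : ℝ) ^ (1 / ε)⌉₊ with hN
  refine ⟨C₁ ^ (N.factorial * n), by positivity, fun L _ _ hL J hJ T hT => ?_⟩
  set s := normalizedFactors J with hs
  have hprime : ∀ P ∈ s, Prime P := fun P hP => prime_of_normalized_factor P hP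
  have hT0 : ∀ I ∈ T, I ≠ 0 := fun I hI h => hJ (zero_dvd_iff.1 (h ▸ hT I hI))
  -- Divisors of `J` correspond to submultisets of its prime factors.
  have h1 : T.card ≤ ∏ P ∈ s.toFinset, (s.count P + 1) := by
    rw [← Multiset.card_Iic]
    refine Finset.card_le_card_of_injOn normalizedFactors (fun I hI => ?_) fun I hI I' hI' h => ?_
    · simpa using (dvd_iff_normalizedFactors_le_normalizedFactors (hT0 I hI) hJ).1 (hT I hI)
    · rw [← Ideal.prod_normalizedFactors_eq_self (hT0 I hI),
        ← Ideal.prod_normalizedFactors_eq_self (hT0 I' hI'), h]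
  have h2 : ∀ P ∈ s.toFinset, ((s.count P + 1 : ℕ) : ℝ) ≤
      (if Ideal.absNorm P ≤ N then C₁ else 1) * ((Ideal.absNorm P : ℝ) ^ ε) ^ s.count P := by
    intro P hP
    have hP' := hprime P (Multiset.mem_toFinset.1 hP)
    have h0 : Ideal.absNorm P ≠ 0 := fun h => hP'.ne_zero (Ideal.absNorm_eq_zero_iff.1 h)
    have h1 : Ideal.absNorm P ≠ 1 := fun h =>
      hP'.not_isUnit (Ideal.isUnit_iff.2 (Ideal.absNorm_eq_one_iff.1 h))
    push_cast
    split_ifs with h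
    · exact nat_succ_le_mul_rpow hε (by exact_mod_cast (by omega : 2 ≤ Ideal.absNorm P)) _
    · rw [one_mul]
      refine nat_succ_le_rpow hε ((Nat.le_ceil _).trans ?_) _
      exact_mod_cast (not_le.1 h).le
  have h3 : (∏ P ∈ s.toFinset, if Ideal.absNorm P ≤ N then C₁ else 1) ≤
      C₁ ^ (N.factorial * n) := by
    rw [← Finset.prod_filter, Finset.prod_const]
    refine pow_le_pow_right₀ hC₁1 (card_primes_absNorm_le hL _ fun P hP => ?_)
    rw [Finset.mem_filter, Multiset.mem_toFinset] at hP
    exact ⟨hprime P hP.1, hP.2⟩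
  have h4 : ∏ P ∈ s.toFinset, ((Ideal.absNorm P : ℝ) ^ ε) ^ s.count P =
      (Ideal.absNorm J : ℝ) ^ ε := by
    conv_rhs => rw [← Ideal.prod_normalizedFactors_eq_self hJ]
    rw [← hs, Finset.prod_multiset_count, map_prod, Nat.cast_prod, ← Real.finsetProd_rpow _ _
      (fun _ _ => by positivity)]
    refine Finset.prod_congr rfl fun P _ => ?_
    rw [map_pow, Nat.cast_pow, ← Real.rpow_natCast, ← Real.rpow_natCast,
      ← Real.rpow_mul (by positivity), ← Real.rpow_mul (by positivity), mul_comm]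
  calc (T.card : ℝ) ≤ ∏ P ∈ s.toFinset, ((s.count P + 1 : ℕ) : ℝ) := by exact_mod_cast h1
    _ ≤ _ := Finset.prod_le_prod (fun _ _ => by positivity) h2
    _ ≤ _ := by
      rw [Finset.prod_mul_distrib, h4]
      gcongr

end DivisorBound

/-! ### Norms and conjugates in a totally real field -/

section Norm

lemma nrm_nonneg {F : Type*} [Field F] (a : 𝓞 F) : 0 ≤ nrm a := abs_nonneg _

variable {F : Type*} [Field F] [NumberField F]

lemma one_le_nrm {a : 𝓞 F} (ha : a ≠ 0) : 1 ≤ nrm a := by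
  rw [nrm, ← Int.cast_abs]
  exact_mod_cast Int.one_le_abs (Algebra.norm_ne_zero_iff.2 ha)

variable [IsTotallyReal F]

/-- The real embeddings of a totally real field are its complex embeddings. -/
def realEmbeddingEquiv (F : Type*) [Field F] [NumberField F] [IsTotallyReal F] :
    (F →+* ℝ) ≃ (F →+* ℂ) where
  toFun σ := Complex.ofRealHom.comp σ
  invFun φ := (IsTotallyReal.complexEmbedding_isReal φ).embedding
  left_inv σ := by
    ext x
    apply Complex.ofReal_injective
    rw [ComplexEmbedding.IsReal.coe_embedding_apply]
    rfl
  right_inv φ := by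
    ext x
    exact ComplexEmbedding.IsReal.coe_embedding_apply _ _

instance : Nonempty (F →+* ℝ) := (realEmbeddingEquiv F).nonempty

lemma nrm_eq_prod (a : 𝓞 F) : nrm a = ∏ σ : F →+* ℝ, |σ (a : F)| := by
  have h1 : ((Algebra.norm ℤ a : ℤ) : ℂ) = ∏ σ : F →+* ℝ, ((σ (a : F) : ℝ) : ℂ) := by
    have h2 := Algebra.norm_eq_prod_embeddings ℚ ℂ (a : F)
    rw [← Algebra.coe_norm_int] at h2
    simp only [eq_ratCast, Rat.cast_intCast] at h2
    rw [h2, ← Equiv.prod_comp (RingHom.equivRatAlgHom F ℂ),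
      ← Equiv.prod_comp (realEmbeddingEquiv F)]
    rfl
  have h2 : ((Algebra.norm ℤ a : ℤ) : ℝ) = ∏ σ : F →+* ℝ, σ (a : F) := by
    exact_mod_cast h1
  rw [nrm, h2, Finset.abs_prod]

/-- A nonzero integer has norm at least 1. This is what turns real inequalities into exact
equations. -/
lemma eq_zero_of_prod_lt_one {a : 𝓞 F} {s : (F →+* ℝ) → ℝ} (h : ∀ σ, |σ (a : F)| ≤ s σ)
    (hs : ∏ σ, s σ < 1) : a = 0 := by
  by_contra ha
  have h1 := one_le_nrm ha
  rw [nrm_eq_prod] at h1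
  have h2 : ∏ σ : F →+* ℝ, |σ (a : F)| ≤ ∏ σ, s σ :=
    Finset.prod_le_prod (fun _ _ => abs_nonneg _) fun σ _ => h σ
  linarith

lemma finite_setOf_abs_le (B : ℝ) : {a : 𝓞 F | ∀ σ : F →+* ℝ, |σ (a : F)| ≤ B}.Finite := by
  refine Set.Finite.of_finite_image (f := fun a : 𝓞 F => (a : F))
    ((Embeddings.finite_of_norm_le F ℂ B).subset ?_) RingOfIntegers.coe_injective.injOn
  rintro _ ⟨a, ha, rfl⟩
  refine ⟨a.isIntegral_coe, fun φ => ?_⟩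
  have h := ha ((realEmbeddingEquiv F).symm φ)
  rw [← (realEmbeddingEquiv F).apply_symm_apply φ]
  change ‖((((realEmbeddingEquiv F).symm φ) (a : F) : ℝ) : ℂ)‖ ≤ B
  rwa [Complex.norm_real, Real.norm_eq_abs]

end Norm

/-! ### Counting solutions of a relative norm equation -/

section NormEquation

lemma card_le_two_of_sq_eq {α R : Type*} [CommRing R] [IsDomain R] {T : Finset α} (f : α → R)
    (hf : Set.InjOn f T) (h : ∀ x ∈ T, ∀ y ∈ T, f x ^ 2 = f y ^ 2) : T.card ≤ 2 := by
  classical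
  rcases T.eq_empty_or_nonempty with rfl | ⟨x₀, hx₀⟩
  · simp
  · refine (Finset.card_le_card_of_injOn (t := {f x₀, -f x₀}) f (fun x hx => ?_) hf).trans
      Finset.card_le_two
    simpa using sq_eq_sq_iff_eq_or_eq_neg.1 (h x hx x₀ hx₀)

/-- Solutions of `u ^ 2 + D v ^ 2 = k` whose ratio to a fixed solution has trace in `A`. -/
lemma card_normEq_fibre_le {F : Type*} [Field F] [NumberField F] {D k : 𝓞 F} (hD : D ≠ 0) (hk : k ≠ 0) {u v : 𝓞 F}
    (huv : u ^ 2 + D * v ^ 2 = k) (A : Finset (𝓞 F)) {T : Finset (𝓞 F × 𝓞 F)}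
    (hT : ∀ z ∈ T, z.1 ^ 2 + D * z.2 ^ 2 = k)
    (hA : ∀ z ∈ T, ∃ a ∈ A, k * a = 2 * (u * z.1 + D * v * z.2)) : T.card ≤ 2 * A.card := by
  classical
  choose! f hfA hf using hA
  refine Finset.card_le_mul_card_image_of_maps_to (f := f) hfA 2 fun a _ => ?_
  -- By Brahmagupta, `(u z₁ + D v z₂)² + D (u z₂ - z₁ v)² = k²`. The trace `a` fixes the first term,
  -- so the second is known up to sign, and the two together recover `z`.
  refine card_le_two_of_sq_eq (fun z => u * z.2 - z.1 * v) ?_ ?_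
  · intro z hz w hw h
    simp only [Finset.coe_filter, Set.mem_ofPred_eq] at hz hw h
    have h1 : 2 * (u * z.1 + D * v * z.2) = 2 * (u * w.1 + D * v * w.2) := by
      rw [← hf z hz.1, ← hf w hw.1, hz.2, hw.2]
    have h2 : u * z.1 + D * v * z.2 = u * w.1 + D * v * w.2 :=
      mul_left_cancel₀ two_ne_zero h1
    have h3 : k * z.1 = k * w.1 := by
      rw [← huv]
      linear_combination u * h2 - D * v * h
    have h4 : k * z.2 = k * w.2 := by
      rw [← huv]
      linear_combination v * h2 + u * h
    exact Prod.ext (mul_left_cancel₀ hk h3) (mul_left_cancel₀ hk h4)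
  · intro z hz w hw
    rw [Finset.mem_filter] at hz hw
    have h1 : 2 * (u * z.1 + D * v * z.2) = 2 * (u * w.1 + D * v * w.2) := by
      rw [← hf z hz.1, ← hf w hw.1, hz.2, hw.2]
    have h2 : u * z.1 + D * v * z.2 = u * w.1 + D * v * w.2 :=
      mul_left_cancel₀ two_ne_zero h1
    have h3 := hT z hz.1
    have h4 := hT w hw.1
    refine mul_left_cancel₀ hD ?_
    linear_combination (u ^ 2 + D * v ^ 2) * (h3 - h4) -
      ((u * z.1 + D * v * z.2) + (u * w.1 + D * v * w.2)) * h2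

/-- If two solutions of `u ^ 2 + D v ^ 2 = k` generate the same ideal of `F(√-D)`, then the trace
of their ratio is a bounded integer of `F`. -/
lemma exists_trace_ratio {F : Type*} [Field F] {L : Type*} [Field L] [NumberField L] [Algebra F L] {D k : 𝓞 F}
    (hD : ∀ σ : F →+* ℝ, 0 < σ (D : F)) (hk : k ≠ 0) {θ : 𝓞 L}
    (hθ : θ ^ 2 = -algebraMap (𝓞 F) (𝓞 L) D) {u v u' v' : 𝓞 F}
    (huv : u ^ 2 + D * v ^ 2 = k) (huv' : u' ^ 2 + D * v' ^ 2 = k)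
    (h : Associated (algebraMap (𝓞 F) (𝓞 L) u + algebraMap (𝓞 F) (𝓞 L) v * θ)
      (algebraMap (𝓞 F) (𝓞 L) u' + algebraMap (𝓞 F) (𝓞 L) v' * θ)) :
    ∃ a : 𝓞 F, (∀ σ : F →+* ℝ, |σ (a : F)| ≤ 2) ∧ k * a = 2 * (u * u' + D * v * v') := by
  obtain ⟨w, hw⟩ := h
  set φ := algebraMap (𝓞 F) (𝓞 L) with hφ
  have hinj : Function.Injective φ := FaithfulSMul.algebraMap_injective _ _
  have hφk : φ k ≠ 0 := by rwa [Ne, map_eq_zero_iff _ hinj]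
  have e1 : φ u ^ 2 + φ D * φ v ^ 2 = φ k := by rw [← huv]; simp
  have e2 : φ u' ^ 2 + φ D * φ v' ^ 2 = φ k := by rw [← huv']; simp
  -- The inverse unit plays the part of the conjugate of `w`: in `w + w⁻¹` the terms in `θ` cancel,
  -- leaving an element of `F` that is integral.
  have hw1 : φ k * w = (φ u' + φ v' * θ) * (φ u - φ v * θ) := by
    rw [← hw, ← e1]
    linear_combination (φ v ^ 2 * w) * hθ
  have hw2 : φ k * ((w⁻¹ : (𝓞 L)ˣ) : 𝓞 L) = (φ u + φ v * θ) * (φ u' - φ v' * θ) := by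
    have h3 : (φ u + φ v * θ) = (φ u' + φ v' * θ) * ((w⁻¹ : (𝓞 L)ˣ) : 𝓞 L) := by
      rw [← hw, mul_assoc, Units.mul_inv, mul_one]
    rw [h3, ← e2]
    linear_combination (φ v' ^ 2 * ((w⁻¹ : (𝓞 L)ˣ) : 𝓞 L)) * hθ
  have hsum : φ k * (w + ((w⁻¹ : (𝓞 L)ˣ) : 𝓞 L)) = φ (2 * (u * u' + D * v * v')) := by
    simp only [map_mul, map_add, map_ofNat]
    linear_combination hw1 + hw2 - 2 * φ v * φ v' * hθ
  have hkF : (k : F) ≠ 0 := by exact_mod_cast hk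
  set q : F := 2 * ((u : F) * u' + D * v * v') / k with hq
  have hqL : algebraMap F L q = ((w + ((w⁻¹ : (𝓞 L)ˣ) : 𝓞 L) : 𝓞 L) : L) := by
    have h3 := congrArg (fun x : 𝓞 L => (x : L)) hsum
    have h4 : ∀ x : 𝓞 F, ((φ x : 𝓞 L) : L) = algebraMap F L (x : F) := fun x =>
      (IsScalarTower.algebraMap_apply (𝓞 F) (𝓞 L) L x).symm.trans
        (IsScalarTower.algebraMap_apply (𝓞 F) F L x)
    have hkL : algebraMap F L (k : F) ≠ 0 := by
      rwa [Ne, map_eq_zero_iff _ (algebraMap F L).injective]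
    rw [hq, map_div₀, div_eq_iff hkL, mul_comm _ (algebraMap F L (k : F))]
    have h5 : algebraMap F L (k : F) * ((w + ((w⁻¹ : (𝓞 L)ˣ) : 𝓞 L) : 𝓞 L) : L) =
        algebraMap F L ((2 * (u * u' + D * v * v') : 𝓞 F) : F) := by
      rw [← h4, ← h4]
      exact h3
    rw [h5]
    simp only [map_mul, map_add]
    rfl
  have hint : IsIntegral ℤ q := by
    rw [← isIntegral_algebraMap_iff (algebraMap F L).injective (B := L), hqL]
    exact RingOfIntegers.isIntegral_coe _
  refine ⟨⟨q, hint⟩, fun σ => ?_, ?_⟩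
  · have e3 : σ (u : F) ^ 2 + σ (D : F) * σ (v : F) ^ 2 = σ (k : F) := by
      rw [← huv]; simp
    have e4 : σ (u' : F) ^ 2 + σ (D : F) * σ (v' : F) ^ 2 = σ (k : F) := by
      rw [← huv']; simp
    have hDσ := hD σ
    have hkσ : 0 < σ (k : F) := by
      have h0 : σ (k : F) ≠ 0 := by simpa using hkF
      refine lt_of_le_of_ne ?_ h0.symm
      rw [← e3]; positivity
    change |σ q| ≤ 2
    rw [hq, map_div₀, abs_div, abs_of_pos hkσ, div_le_iff₀ hkσ]
    simp only [map_mul, map_add, map_ofNat]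
    rw [abs_mul, abs_of_pos (two_pos : (0 : ℝ) < 2)]
    gcongr
    -- Cauchy–Schwarz for the positive form `X² + σ(D) Y²`.
    refine abs_le_of_sq_le_sq ?_ hkσ.le
    calc _ ≤ (σ (u : F) ^ 2 + σ (D : F) * σ (v : F) ^ 2) *
          (σ (u' : F) ^ 2 + σ (D : F) * σ (v' : F) ^ 2) := by
          nlinarith [mul_nonneg hDσ.le (sq_nonneg (σ (u : F) * σ (v' : F) - σ (u' : F) * σ (v : F)))]
      _ = _ := by rw [e3, e4]; ring
  · apply RingOfIntegers.coe_injective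
    change (k : F) * q = _
    rw [hq, mul_div_cancel₀ _ hkF]
    simp only [map_mul, map_add]
    rfl

/-- The number of solutions of the norm equation `u ^ 2 + D v ^ 2 = k` with `D` totally
positive is at most `N(k) ^ ε`, uniformly in `D`. -/
lemma exists_card_normEq_le (F : Type*) [Field F] [NumberField F] [IsTotallyReal F] {ε : ℝ}
    (hε : 0 < ε) : ∃ C : ℝ, 0 < C ∧ ∀ D k : 𝓞 F, (∀ σ : F →+* ℝ, 0 < σ (D : F)) → k ≠ 0 →
      ∀ T : Finset (𝓞 F × 𝓞 F), (∀ z ∈ T, z.1 ^ 2 + D * z.2 ^ 2 = k) →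
        (T.card : ℝ) ≤ C * nrm k ^ ε := by
  classical
  -- `F(√-D)` has degree at most 2 over `F`, so the ideal `(k)` there has norm at most `N(k)²`;
  -- hence the exponent `ε / 2`.
  obtain ⟨C, hC, hdiv⟩ := exists_card_ideal_dvd_le (Module.finrank ℚ F * 2) (half_pos hε)
  set A := (finite_setOf_abs_le (F := F) 2).toFinset with hA
  refine ⟨2 * (A.card + 1) * C, by positivity, fun D k hD hk T hT => ?_⟩
  have hD0 : D ≠ 0 := by
    rintro rfl
    simpa using hD (Classical.arbitrary _)
  obtain ⟨θ₀, hθ₀⟩ := IsAlgClosed.exists_pow_nat_eq (-algebraMap F (AlgebraicClosure F) (D : F))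
    (n := 2) two_pos
  have hθint : IsIntegral F θ₀ := ⟨Polynomial.X ^ 2 + Polynomial.C (D : F),
    Polynomial.monic_X_pow_add_C _ two_ne_zero, by simp [hθ₀]⟩
  let L := IntermediateField.adjoin F {θ₀}
  have : FiniteDimensional F L := IntermediateField.adjoin.finiteDimensional hθint
  have : NumberField L := NumberField.of_module_finite F L
  have hrank : Module.finrank F L ≤ 2 := by
    have h1 : Module.finrank F L = (minpoly F θ₀).natDegree :=
      IntermediateField.adjoin.finrank hθint
    rw [h1]
    refine (Polynomial.natDegree_le_of_dvd (minpoly.dvd F θ₀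
      (p := Polynomial.X ^ 2 + Polynomial.C (D : F)) (by simp [hθ₀]))
      (Polynomial.monic_X_pow_add_C _ two_ne_zero).ne_zero).trans ?_
    rw [Polynomial.natDegree_X_pow_add_C]
  have hrankQ : Module.finrank ℚ L ≤ Module.finrank ℚ F * 2 := by
    rw [← Module.finrank_mul_finrank ℚ F L]
    gcongr
  let θ₁ : L := ⟨θ₀, IntermediateField.mem_adjoin_simple_self F θ₀⟩
  have hθ₁ : θ₁ ^ 2 = -algebraMap F L (D : F) := Subtype.ext hθ₀
  have hθ₁int : IsIntegral ℤ θ₁ := by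
    refine IsIntegral.of_pow two_pos ?_
    rw [hθ₁]
    exact (D.isIntegral_coe.algebraMap).neg
  let θ : 𝓞 L := ⟨θ₁, hθ₁int⟩
  set φ := algebraMap (𝓞 F) (𝓞 L) with hφ
  have hφL : ∀ x : 𝓞 F, ((φ x : 𝓞 L) : L) = algebraMap F L (x : F) := fun x =>
    (IsScalarTower.algebraMap_apply (𝓞 F) (𝓞 L) L x).symm.trans
      (IsScalarTower.algebraMap_apply (𝓞 F) F L x)
  have hθ : θ ^ 2 = -φ D := by
    apply RingOfIntegers.coe_injective
    change θ₁ ^ 2 = -((φ D : 𝓞 L) : L)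
    rw [hθ₁, hφL]
  have hinj : Function.Injective φ := FaithfulSMul.algebraMap_injective _ _
  have hφk : φ k ≠ 0 := by rwa [Ne, map_eq_zero_iff _ hinj]
  let I : 𝓞 F × 𝓞 F → Ideal (𝓞 L) := fun z => Ideal.span {φ z.1 + φ z.2 * θ}
  have hJ : Ideal.span {φ k} ≠ ⊥ := by rwa [Ne, Ideal.span_singleton_eq_bot]
  have h1 := hdiv L hrankQ _ hJ (T.image I) (by
    intro J hJ
    obtain ⟨z, hz, rfl⟩ := Finset.mem_image.1 hJ
    rw [Ideal.dvd_span_singleton, Ideal.mem_span_singleton]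
    refine ⟨φ z.1 - φ z.2 * θ, ?_⟩
    rw [← hT z hz]
    simp only [map_add, map_mul, map_pow]
    linear_combination φ z.2 ^ 2 * hθ)
  have h2 : T.card ≤ 2 * A.card * (T.image I).card := by
    refine Finset.card_le_mul_card_image _ _ fun J hJ => ?_
    obtain ⟨z, hz, rfl⟩ := Finset.mem_image.1 hJ
    refine card_normEq_fibre_le hD0 hk (hT z hz) A (fun w hw => hT w (Finset.mem_filter.1 hw).1)
      fun w hw => ?_
    rw [Finset.mem_filter] at hw
    obtain ⟨a, ha, hka⟩ := exists_trace_ratio hD hk hθ (hT z hz) (hT w hw.1)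
      (Ideal.span_singleton_eq_span_singleton.1 hw.2.symm)
    exact ⟨a, by simpa [hA] using ha, hka⟩
  have h3 : (Ideal.absNorm (Ideal.span {φ k}) : ℝ) ≤ nrm k ^ (2 : ℝ) := by
    have h4 : Algebra.norm ℤ (φ k) = Algebra.norm ℤ k ^ Module.finrank F L := by
      have h5 : ((Algebra.norm ℤ (φ k) : ℤ) : ℚ) = (Algebra.norm ℤ k : ℤ) ^ Module.finrank F L := by
        rw [Algebra.coe_norm_int, hφL, ← Algebra.norm_norm (S := F), Algebra.norm_algebraMap, map_pow,
          ← Algebra.coe_norm_int]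
      exact_mod_cast h5
    rw [Ideal.absNorm_span_singleton, h4, Real.rpow_ofNat]
    have h5 : (((Algebra.norm ℤ k ^ Module.finrank F L).natAbs : ℕ) : ℝ) =
        nrm k ^ Module.finrank F L := by
      rw [Nat.cast_natAbs, nrm]
      push_cast
      rw [abs_pow]
    rw [h5]
    exact pow_le_pow_right₀ (one_le_nrm hk) hrank
  have h4 : (Ideal.absNorm (Ideal.span {φ k}) : ℝ) ^ (ε / 2) ≤ nrm k ^ ε := by
    calc _ ≤ (nrm k ^ (2 : ℝ)) ^ (ε / 2) := by gcongr
      _ = _ := by rw [← Real.rpow_mul (nrm_nonneg k), mul_div_cancel₀ _ two_ne_zero]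
  calc (T.card : ℝ) ≤ 2 * A.card * (T.image I).card := by exact_mod_cast h2
    _ ≤ 2 * (A.card + 1) * (C * nrm k ^ ε) := by
      gcongr
      · linarith
      · exact h1.trans (by gcongr)
    _ = _ := by ring

end NormEquation

/-! ### Gram determinants of two and three vectors -/

section Gram

open QuadraticMap

variable {R V : Type*} [CommRing R] [AddCommGroup V] [Module R V] (Q : QuadraticForm R V)

/-- The Gram determinant of two vectors for the polar form of `Q`. -/
def gram₂ (p q : V) : R := 4 * Q p * Q q - polar Q p q ^ 2

/-- Half the Gram determinant of three vectors for the polar form of `Q`. -/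
def gram₃ (p q r : V) : R :=
  4 * Q p * Q q * Q r + polar Q p q * polar Q q r * polar Q p r - Q p * polar Q q r ^ 2 -
    Q q * polar Q p r ^ 2 - Q r * polar Q p q ^ 2

lemma map_smul_add_smul (a b : R) (x y : V) :
    Q (a • x + b • y) = a ^ 2 * Q x + b ^ 2 * Q y + a * b * polar Q x y := by
  rw [QuadraticMap.map_add Q, QuadraticMap.map_smul, QuadraticMap.map_smul, polar_smul_left, polar_smul_right]
  simp only [smul_eq_mul]
  ring

lemma polar_smul_add_smul_left (a b : R) (x y z : V) :
    polar Q (a • x + b • y) z = a * polar Q x z + b * polar Q y z := by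
  rw [polar_add_left, polar_smul_left, polar_smul_left]
  simp only [smul_eq_mul]

lemma polar_smul_add_smul_right (a b : R) (x y z : V) :
    polar Q z (a • x + b • y) = a * polar Q z x + b * polar Q z y := by
  rw [polar_comm, polar_smul_add_smul_left, polar_comm Q x, polar_comm Q y]

/-- The argument of `Q` is `2 Q p` times the component of `r` orthogonal to `p`. -/
lemma map_gram₂_rejection (p r : V) :
    Q ((2 * Q p) • r + (-polar Q p r) • p) = Q p * gram₂ Q p r := by
  rw [map_smul_add_smul, polar_comm Q r p, gram₂]
  ring

/-- Cramer's rule: the argument is `gram₂ Q p q` times the component of `r` orthogonal to `p` and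
`q`. For an anisotropic form it therefore vanishes as soon as `gram₃` does. -/
lemma map_gram₃_rejection (p q r : V) :
    Q (gram₂ Q p q • r + (1 : R) • ((polar Q p q * polar Q q r - 2 * Q q * polar Q p r) • p +
      (polar Q p q * polar Q p r - 2 * Q p * polar Q q r) • q)) =
      gram₂ Q p q * gram₃ Q p q r := by
  rw [map_smul_add_smul, map_smul_add_smul, polar_smul_add_smul_right, polar_comm Q r p,
    polar_comm Q r q, gram₂, gram₃]
  ring

/-- Three vectors in a plane have vanishing Gram determinant. -/
lemma gram₃_eq_zero_of_plane (e f : V) (a b c a' b' c' : R) :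
    gram₃ Q (a • e + a' • f) (b • e + b' • f) (c • e + c' • f) = 0 := by
  simp only [gram₃, map_smul_add_smul, polar_smul_add_smul_left, polar_smul_add_smul_right,
    polar_self, polar_comm Q f e]
  ring

end Gram

/-! ### Points of the quadric on a line or a plane -/

section Coplanar

open QuadraticMap

variable {F V : Type*} [Field F] [AddCommGroup V] [Module (𝓞 F) V]
  {Q : QuadraticForm (𝓞 F) V}

lemma embedding_ofNat {F : Type*} [Field F] [CharZero F] (n : ℕ) [n.AtLeastTwo] (σ : F →+* ℝ) :
    σ (algebraMap (𝓞 F) F (OfNat.ofNat n)) = OfNat.ofNat n :=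
  map_ofNat (σ.comp (algebraMap (𝓞 F) F)) n

lemma embedding_map_nonneg (hQ : ∀ y : V, y ≠ 0 → ∀ σ : F →+* ℝ, 0 < σ (Q y : F)) (y : V)
    (σ : F →+* ℝ) : 0 ≤ σ (Q y : F) := by
  rcases eq_or_ne y 0 with rfl | hy
  · simp
  · exact (hQ y hy σ).le

lemma eq_zero_of_map_eq_zero [Nonempty (F →+* ℝ)] (hQ : ∀ y : V, y ≠ 0 → ∀ σ : F →+* ℝ, 0 < σ (Q y : F)) {y : V}
    (hy : Q y = 0) : y = 0 := by
  by_contra h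
  have := hQ y h (Classical.arbitrary _)
  simp [hy] at this

/-- Cauchy–Schwarz, read off from `Q p * gram₂ Q p q` being a value of `Q`. -/
lemma embedding_gram₂_nonneg (hQ : ∀ y : V, y ≠ 0 → ∀ σ : F →+* ℝ, 0 < σ (Q y : F)) (p q : V)
    (σ : F →+* ℝ) : 0 ≤ σ ((gram₂ Q p q : 𝓞 F) : F) := by
  rcases eq_or_ne p 0 with rfl | hp
  · simp [gram₂]
  · have h1 := embedding_map_nonneg hQ ((2 * Q p) • q + (-polar Q p q) • p) σ
    rw [map_gram₂_rejection] at h1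
    have h2 := hQ p hp σ
    simp only [map_mul] at h1
    exact nonneg_of_mul_nonneg_right h1 h2

lemma smul_eq_of_gram₂_eq_zero [Nonempty (F →+* ℝ)]
    (hQ : ∀ y : V, y ≠ 0 → ∀ σ : F →+* ℝ, 0 < σ (Q y : F)) {p r : V}
    (h : gram₂ Q p r = 0) : (2 * Q p) • r = polar Q p r • p := by
  have h1 := eq_zero_of_map_eq_zero hQ ((map_gram₂_rejection Q p r).trans (by rw [h, mul_zero]))
  rwa [neg_smul, ← sub_eq_add_neg, sub_eq_zero] at h1

lemma smul_eq_of_gram₃_eq_zero [Nonempty (F →+* ℝ)]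
    (hQ : ∀ y : V, y ≠ 0 → ∀ σ : F →+* ℝ, 0 < σ (Q y : F)) {p q r : V}
    (h : gram₃ Q p q r = 0) : gram₂ Q p q • r =
      (2 * Q q * polar Q p r - polar Q p q * polar Q q r) • p +
      (2 * Q p * polar Q q r - polar Q p q * polar Q p r) • q := by
  have h1 := eq_zero_of_map_eq_zero hQ ((map_gram₃_rejection Q p q r).trans (by rw [h, mul_zero]))
  rw [one_smul] at h1
  rw [eq_neg_of_add_eq_zero_left h1]
  module

/-- Anisotropy makes the module torsion-free. -/
lemma eq_of_smul_eq [Nonempty (F →+* ℝ)] (hQ : ∀ y : V, y ≠ 0 → ∀ σ : F →+* ℝ, 0 < σ (Q y : F)) {a : 𝓞 F}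
    (ha : a ≠ 0) {x y : V} (h : a • x = a • y) : x = y := by
  have h1 : a • (x - y) = 0 := by rw [smul_sub, h, sub_self]
  have h2 : a * a * Q (x - y) = 0 := by
    rw [← smul_eq_mul (a * a), ← QuadraticMap.map_smul, h1, map_zero]
  have h3 : Q (x - y) = 0 := by simpa [ha] using h2
  exact sub_eq_zero.1 (eq_zero_of_map_eq_zero hQ h3)

lemma embedding_gram₂_pos (hQ : ∀ y : V, y ≠ 0 → ∀ σ : F →+* ℝ, 0 < σ (Q y : F)) {p q : V}
    (h : gram₂ Q p q ≠ 0) (σ : F →+* ℝ) : 0 < σ ((gram₂ Q p q : 𝓞 F) : F) := by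
  refine lt_of_le_of_ne (embedding_gram₂_nonneg hQ p q σ) fun h0 => h ?_
  have := (map_eq_zero σ).1 h0.symm
  exact_mod_cast this

/-- An affine plane section of the quadric `Q = l`, written as a norm equation. -/
lemma normEq_of_gram₃_eq_zero [Nonempty (F →+* ℝ)]
    (hQ : ∀ y : V, y ≠ 0 → ∀ σ : F →+* ℝ, 0 < σ (Q y : F)) {l : 𝓞 F}
    {v₀ p q y : V} (hv₀ : Q v₀ = l) (hy : Q y = l) (h : gram₃ Q p q (y - v₀) = 0) :
    (2 * Q p * polar Q y q - polar Q p q * polar Q y p) ^ 2 + gram₂ Q p q * polar Q y p ^ 2 =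
      (2 * Q p * polar Q v₀ q - polar Q p q * polar Q v₀ p) ^ 2 +
        gram₂ Q p q * polar Q v₀ p ^ 2 := by
  -- Either side is `4 Q(p) gram₂(p, q) Q(π ·)` when `gram₂ ≠ 0`, with `π` the orthogonal projection
  -- to the span of `p, q`. As `r` lies in that span, `y` and `v₀` have the same orthogonal
  -- component, so `Q y = Q v₀` gives `Q(π y) = Q(π v₀)`.
  set r := y - v₀ with hr
  have hyr : y = v₀ + r := by rw [hr]; abel
  have h1 : Q r + polar Q v₀ r = 0 := by
    rw [hyr, QuadraticMap.map_add Q, hv₀] at hy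
    linear_combination hy
  have h2 := smul_eq_of_gram₃_eq_zero hQ h
  have h3 := congrArg (polar Q v₀) h2
  have h4 : 2 * gram₂ Q p q * Q r = (2 * Q q * polar Q p r - polar Q p q * polar Q q r) * polar Q p r +
      (2 * Q p * polar Q q r - polar Q p q * polar Q p r) * polar Q q r := by
    have h5 := congrArg (polar Q r) h2
    rw [polar_smul_right, polar_smul_add_smul_right, polar_self, polar_comm Q r p,
      polar_comm Q r q] at h5
    simp only [smul_eq_mul] at h5
    linear_combination h5
  rw [polar_smul_right, polar_smul_add_smul_right, smul_eq_mul] at h3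
  rw [hyr, polar_add_left, polar_add_left, polar_comm Q r p, polar_comm Q r q]
  rw [gram₂] at *
  linear_combination (-2 * Q p) * h4 - 4 * Q p * h3 + 4 * Q p * (4 * Q p * Q q - polar Q p q ^ 2) * h1

variable [NumberField F]

lemma embedding_polar_sq_le (hQ : ∀ y : V, y ≠ 0 → ∀ σ : F →+* ℝ, 0 < σ (Q y : F)) (p q : V)
    (σ : F →+* ℝ) : σ ((polar Q p q : 𝓞 F) : F) ^ 2 ≤ 4 * σ (Q p : F) * σ (Q q : F) := by
  have h := embedding_gram₂_nonneg hQ p q σ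
  simp only [gram₂, map_sub, map_mul, map_pow, map_ofNat] at h
  linarith

/-- Parallelogram law. -/
lemma embedding_map_sub_le (hQ : ∀ y : V, y ≠ 0 → ∀ σ : F →+* ℝ, 0 < σ (Q y : F)) {p q : V}
    {l : 𝓞 F} (hp : Q p = l) (hq : Q q = l) (σ : F →+* ℝ) : σ (Q (p - q) : F) ≤ 4 * σ (l : F) := by
  have h1 : Q (p - q) + Q (p + q) = 4 * l := by
    rw [sub_eq_add_neg, QuadraticMap.map_add Q, QuadraticMap.map_add Q, polar_neg_right,
      QuadraticMap.map_neg, hp, hq]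
    ring
  have h2 : σ (Q (p - q) : F) + σ (Q (p + q) : F) = 4 * σ (l : F) := by
    rw [← map_add, ← map_add, h1, map_mul, map_mul, embedding_ofNat]
  linarith [embedding_map_nonneg hQ (p + q) σ]

variable [Nonempty (F →+* ℝ)]

/-- A line meets the quadric `Q = l` in at most two points. -/
lemma card_le_two_of_collinear (hQ : ∀ y : V, y ≠ 0 → ∀ σ : F →+* ℝ, 0 < σ (Q y : F)) {l : 𝓞 F}
    {T : Finset V} (hT : ∀ y ∈ T, Q y = l) {v₀ p : V} (hv₀ : Q v₀ = l) (hp : p ≠ 0)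
    (h : ∀ y ∈ T, gram₂ Q p (y - v₀) = 0) : T.card ≤ 2 := by
  have hQp : Q p ≠ 0 := fun h => hp (eq_zero_of_map_eq_zero hQ h)
  -- This coordinate is `polar Q p y`. Completing the square in `Q r + polar Q v₀ r = 0` along the
  -- line shows that its square is constant.
  refine card_le_two_of_sq_eq (fun y => polar Q p (y - v₀) + polar Q v₀ p) ?_ ?_
  · intro y hy z hz hyz
    have h1 : polar Q p (y - v₀) = polar Q p (z - v₀) := add_right_cancel hyz
    have h2 := smul_eq_of_gram₂_eq_zero hQ (h y hy)
    rw [h1, ← smul_eq_of_gram₂_eq_zero hQ (h z hz)] at h2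
    exact sub_left_injective (eq_of_smul_eq hQ (mul_ne_zero two_ne_zero hQp) h2)
  · have key : ∀ y ∈ T, (polar Q p (y - v₀) + polar Q v₀ p) ^ 2 = polar Q v₀ p ^ 2 := by
      intro y hy
      set r := y - v₀ with hr
      have h1 : Q r + polar Q v₀ r = 0 := by
        have h3 := hT y hy
        rw [show y = v₀ + r by rw [hr]; abel, QuadraticMap.map_add Q, hv₀] at h3
        linear_combination h3
      have h2 : 2 * Q p * polar Q v₀ r = polar Q p r * polar Q v₀ p := by
        have h3 := congrArg (polar Q v₀) (smul_eq_of_gram₂_eq_zero hQ (h y hy))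
        rwa [polar_smul_right, polar_smul_right] at h3
      have h3 : 4 * Q p * Q r = polar Q p r ^ 2 := sub_eq_zero.1 (h y hy)
      linear_combination 4 * Q p * h1 - h3 - 2 * h2
    intro y hy z hz
    rw [key y hy, key z hz]

end Coplanar

/-- Coplanar points on the quadric `Q = l` number at most `N(l) ^ ε`, uniformly in `Q`. -/
lemma exists_card_coplanar_le (F : Type*) [Field F] [NumberField F] [IsTotallyReal F] {ε : ℝ}
    (hε : 0 < ε) : ∃ C : ℝ, 0 < C ∧ ∀ (V : Type*) [AddCommGroup V] [Module (𝓞 F) V]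
      (Q : QuadraticForm (𝓞 F) V), (∀ y : V, y ≠ 0 → ∀ σ : F →+* ℝ, 0 < σ (Q y : F)) →
      ∀ l : 𝓞 F, l ≠ 0 → ∀ T : Finset V, (∀ y ∈ T, Q y = l) →
      (∀ y₀ ∈ T, ∀ y₁ ∈ T, ∀ y₂ ∈ T, ∀ y₃ ∈ T, gram₃ Q (y₁ - y₀) (y₂ - y₀) (y₃ - y₀) = 0) →
        (T.card : ℝ) ≤ C * nrm l ^ ε := by
  classical
  obtain ⟨C, hC, hnorm⟩ := exists_card_normEq_le F (ε := ε / 4) (by positivity)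
  -- At each place `k ≤ 5120 l⁴`: with the bounds `c7`, `c8`, `c9` below, `64·16 + 8·(16·16) +
  -- 2·(64·16) = 5120`. The fourth power accounts for `ε / 4`.
  set K : ℝ := ∏ _σ : F →+* ℝ, (5120 : ℝ) with hK
  have hK0 : 0 < K := Finset.prod_pos fun _ _ => by norm_num
  refine ⟨C * K ^ (ε / 4) + 2, by positivity, fun V _ _ Q hQ l hl T hT hG => ?_⟩
  have hl1 : 1 ≤ nrm l ^ ε := Real.one_le_rpow (one_le_nrm hl) hε.le
  have hsmall : T.card ≤ 2 → (T.card : ℝ) ≤ (C * K ^ (ε / 4) + 2) * nrm l ^ ε := fun h => by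
    have h1 : (T.card : ℝ) ≤ 2 := by exact_mod_cast h
    have h2 : 0 ≤ C * K ^ (ε / 4) * nrm l ^ ε := by positivity
    linarith
  by_cases h1 : T.card ≤ 2
  · exact hsmall h1
  -- The directions `p, q` are differences of points of `T` itself, so their sizes are controlled by
  -- `l` alone.
  obtain ⟨v₀, hv₀, v₁, hv₁, hne⟩ := Finset.one_lt_card.1 (by omega : 1 < T.card)
  set p := v₁ - v₀ with hp
  have hp0 : p ≠ 0 := sub_ne_zero.2 hne.symm
  have hQp : Q p ≠ 0 := fun h => hp0 (eq_zero_of_map_eq_zero hQ h)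
  by_cases h2 : ∀ y ∈ T, gram₂ Q p (y - v₀) = 0
  · exact hsmall (card_le_two_of_collinear hQ hT (hT v₀ hv₀) hp0 h2)
  push Not at h2
  obtain ⟨v₂, hv₂, hD⟩ := h2
  set q := v₂ - v₀ with hq
  set b := QuadraticMap.polar Q with hb
  set D := gram₂ Q p q with hDdef
  have hDpos : ∀ σ : F →+* ℝ, 0 < σ (D : F) := embedding_gram₂_pos hQ hD
  set k : 𝓞 F := (2 * Q p * b v₀ q - b p q * b v₀ p) ^ 2 + D * b v₀ p ^ 2 with hk
  set f : V → 𝓞 F × 𝓞 F := fun y => (2 * Q p * b y q - b p q * b y p, b y p) with hf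
  have hinj : Set.InjOn f T := by
    intro y hy z hz h
    have e1 : b y p = b z p := congrArg Prod.snd h
    have e2 : b y q = b z q := by
      have h3 : 2 * Q p * b y q - b p q * b y p = 2 * Q p * b z q - b p q * b z p :=
        congrArg Prod.fst h
      rw [e1] at h3
      exact mul_left_cancel₀ (mul_ne_zero two_ne_zero hQp) (sub_left_injective h3)
    have e3 : ∀ x, b p (x - v₀) = b x p - b v₀ p := fun x => by
      rw [hb, QuadraticMap.polar_sub_right, QuadraticMap.polar_comm Q p x,
        QuadraticMap.polar_comm Q p v₀]
    have e4 : ∀ x, b q (x - v₀) = b x q - b v₀ q := fun x => by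
      rw [hb, QuadraticMap.polar_sub_right, QuadraticMap.polar_comm Q q x,
        QuadraticMap.polar_comm Q q v₀]
    have h4 := smul_eq_of_gram₃_eq_zero hQ (hG v₀ hv₀ v₁ hv₁ v₂ hv₂ y hy)
    have h5 := smul_eq_of_gram₃_eq_zero hQ (hG v₀ hv₀ v₁ hv₁ v₂ hv₂ z hz)
    rw [← hp, ← hq, ← hb, ← hDdef, e3, e4] at h4 h5
    rw [e1, e2, ← h5] at h4
    exact sub_left_injective (eq_of_smul_eq hQ hD h4)
  have heq : ∀ z ∈ T.image f, z.1 ^ 2 + D * z.2 ^ 2 = k := by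
    intro z hz
    obtain ⟨y, hy, rfl⟩ := Finset.mem_image.1 hz
    exact normEq_of_gram₃_eq_zero hQ (hT v₀ hv₀) (hT y hy) (hG v₀ hv₀ v₁ hv₁ v₂ hv₂ y hy)
  have hkbound : ∀ σ : F →+* ℝ, |σ (k : F)| ≤ 5120 * |σ (l : F)| ^ 4 := by
    intro σ
    have hlσ : 0 ≤ σ (l : F) := hT v₀ hv₀ ▸ embedding_map_nonneg hQ v₀ σ
    have a1 := embedding_map_sub_le hQ (hT v₁ hv₁) (hT v₀ hv₀) σ
    have a2 := embedding_map_sub_le hQ (hT v₂ hv₂) (hT v₀ hv₀) σ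
    rw [← hp] at a1
    rw [← hq] at a2
    have a3 := embedding_polar_sq_le hQ v₀ p σ
    have a4 := embedding_polar_sq_le hQ v₀ q σ
    have a5 := embedding_polar_sq_le hQ p q σ
    have a6 := embedding_map_nonneg hQ p σ
    have a7 := embedding_map_nonneg hQ q σ
    have hD0 := (hDpos σ).le
    have hDe : σ (D : F) = 4 * σ (Q p : F) * σ (Q q : F) - σ (b p q : F) ^ 2 := by
      rw [hDdef, gram₂]
      simp only [map_sub, map_mul, map_pow]
      rw [embedding_ofNat]
    have hke : σ (k : F) = (2 * σ (Q p : F) * σ (b v₀ q : F) - σ (b p q : F) * σ (b v₀ p : F)) ^ 2 +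
        σ (D : F) * σ (b v₀ p : F) ^ 2 := by
      rw [hk]
      simp only [map_sub, map_mul, map_pow, map_add]
      rw [embedding_ofNat]
    rw [hT v₀ hv₀] at a3 a4
    rw [← hb] at a3 a4 a5
    generalize σ (k : F) = k' at *
    generalize σ (D : F) = D' at *
    generalize σ (l : F) = l' at *
    generalize σ (Q p : F) = P at *
    generalize σ (Q q : F) = P' at *
    generalize σ (b v₀ q : F) = Y at *
    generalize σ (b v₀ p : F) = X at *
    generalize σ (b p q : F) = B at *
    have c1 : X ^ 2 ≤ 16 * l' ^ 2 := by nlinarith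
    have c2 : Y ^ 2 ≤ 16 * l' ^ 2 := by nlinarith
    have c3 : P * P' ≤ 16 * l' ^ 2 := by nlinarith
    have c4 : P ^ 2 ≤ 16 * l' ^ 2 := by nlinarith
    have c5 : B ^ 2 ≤ 64 * l' ^ 2 := by nlinarith
    have c6 : D' ≤ 64 * l' ^ 2 := by nlinarith [sq_nonneg B]
    have c7 : D' * X ^ 2 ≤ 64 * l' ^ 2 * (16 * l' ^ 2) := by gcongr
    have c8 : P ^ 2 * Y ^ 2 ≤ 16 * l' ^ 2 * (16 * l' ^ 2) := by gcongr
    have c9 : B ^ 2 * X ^ 2 ≤ 64 * l' ^ 2 * (16 * l' ^ 2) := by gcongr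
    have c10 : (2 * P * Y - B * X) ^ 2 ≤ 8 * (P ^ 2 * Y ^ 2) + 2 * (B ^ 2 * X ^ 2) := by
      nlinarith [sq_nonneg (2 * P * Y + B * X)]
    have c11 : 0 ≤ k' := by rw [hke]; positivity
    rw [abs_of_nonneg c11, abs_of_nonneg hlσ, hke]
    nlinarith
  -- If `k = 0`, definiteness leaves only the solution `(0, 0)`, against `T` having more than two
  -- points.
  have hk0 : k ≠ 0 := by
    intro hk0
    have h3 : T.card ≤ 1 := by
      rw [← Finset.card_image_of_injOn hinj, Finset.card_le_one]
      have h4 : ∀ z ∈ T.image f, z = 0 := by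
        intro z hz
        have h5 := heq z hz
        rw [hk0] at h5
        set σ : F →+* ℝ := Classical.arbitrary _
        have h6 : σ (z.1 : F) ^ 2 + σ (D : F) * σ (z.2 : F) ^ 2 = 0 := by
          have := congrArg (fun x : 𝓞 F => σ (x : F)) h5
          simpa using this
        have h7 := hDpos σ
        have h8 : σ (z.1 : F) ^ 2 = 0 := by nlinarith [sq_nonneg (σ (z.1 : F)), sq_nonneg (σ (z.2 : F))]
        have h9 : σ (z.2 : F) ^ 2 = 0 := by nlinarith [sq_nonneg (σ (z.1 : F)), sq_nonneg (σ (z.2 : F))]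
        refine Prod.ext ?_ ?_
        · simpa using h8
        · simpa using h9
      intro a ha c hc
      rw [h4 a ha, h4 c hc]
    omega
  have hfin := hnorm D k hDpos hk0 _ heq
  rw [Finset.card_image_of_injOn hinj] at hfin
  have hnk : nrm k ≤ K * nrm l ^ (4 : ℝ) := by
    rw [nrm_eq_prod, nrm_eq_prod, hK, Real.rpow_ofNat, ← Finset.prod_pow, ← Finset.prod_mul_distrib]
    exact Finset.prod_le_prod (fun _ _ => abs_nonneg _) fun σ _ => hkbound σ
  have hnl := nrm_nonneg l
  calc (T.card : ℝ) ≤ C * nrm k ^ (ε / 4) := hfin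
    _ ≤ C * (K * nrm l ^ (4 : ℝ)) ^ (ε / 4) := by
      have := nrm_nonneg k
      gcongr
    _ = C * K ^ (ε / 4) * nrm l ^ ε := by
      rw [Real.mul_rpow hK0.le (by positivity), ← Real.rpow_mul hnl, mul_div_cancel₀ _ four_ne_zero]
      ring
    _ ≤ _ := by nlinarith

/-! ### Subdivision into cells -/

section Cells

/-- Counting by subdivision: if the points of `T` are cut into cells on which the functions `g k`
vary by at most `s k`, then `T` has at most `∏ 4 L k / s k` times as many points as a cell. -/
lemma card_le_of_cells {α κ : Type*} [Fintype κ] (T : Finset α) (g : κ → α → ℝ) {L s : κ → ℝ}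
    (hs : ∀ k, 0 < s k) (hsL : ∀ k, s k ≤ L k) (hg : ∀ y ∈ T, ∀ k, |g k y| ≤ L k) {B : ℝ}
    (hB : ∀ T' ⊆ T, (∀ y ∈ T', ∀ y' ∈ T', ∀ k, |g k y - g k y'| ≤ s k) → (T'.card : ℝ) ≤ B) :
    (T.card : ℝ) ≤ (∏ k, 4 * (L k / s k)) * B := by
  classical
  have hB0 : 0 ≤ B := by simpa using hB ∅ (Finset.empty_subset _) (by simp)
  set f : α → κ → ℤ := fun y k => ⌊g k y / s k⌋ with hf
  set P := Fintype.piFinset fun k => Finset.Icc ⌊-(L k / s k)⌋ ⌊L k / s k⌋ with hP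
  have hmaps : ∀ y ∈ T, f y ∈ P := by
    intro y hy
    rw [hP, Fintype.mem_piFinset]
    intro k
    have h1 := abs_le.1 (hg y hy k)
    rw [Finset.mem_Icc]
    constructor
    · apply Int.floor_le_floor
      rw [← neg_div]
      exact div_le_div_of_nonneg_right h1.1 (hs k).le
    · exact Int.floor_le_floor (div_le_div_of_nonneg_right h1.2 (hs k).le)
  have hcardP : (P.card : ℝ) ≤ ∏ k, 4 * (L k / s k) := by
    rw [hP, Fintype.card_piFinset, Nat.cast_prod]
    refine Finset.prod_le_prod (fun _ _ => by positivity) fun k _ => ?_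
    -- With `t = L k / s k ≥ 1` there are at most `2 t + 2 ≤ 4 t` cells in each direction.
    have h1 : 1 ≤ L k / s k := (one_le_div (hs k)).2 (hsL k)
    rw [Int.card_Icc]
    have h2 : (⌊-(L k / s k)⌋ : ℝ) ≤ ⌊L k / s k⌋ := by
      exact_mod_cast Int.floor_le_floor (by linarith)
    have h3 : (0 : ℤ) ≤ ⌊L k / s k⌋ + 1 - ⌊-(L k / s k)⌋ := by
      have : ⌊-(L k / s k)⌋ ≤ ⌊L k / s k⌋ := by exact_mod_cast h2
      omega
    have h4 : ((⌊L k / s k⌋ + 1 - ⌊-(L k / s k)⌋).toNat : ℝ) =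
        (⌊L k / s k⌋ + 1 - ⌊-(L k / s k)⌋ : ℤ) := by
      exact_mod_cast congrArg (fun z : ℤ => (z : ℝ)) (Int.toNat_of_nonneg h3)
    rw [h4]
    push_cast
    have := Int.floor_le (L k / s k)
    have := Int.lt_floor_add_one (-(L k / s k))
    linarith
  have hfib : ∀ b ∈ P, (({y ∈ T | f y = b} : Finset α).card : ℝ) ≤ B := by
    intro b _
    refine hB _ (Finset.filter_subset _ _) fun y hy y' hy' k => ?_
    rw [Finset.mem_filter] at hy hy'
    have h1 : ⌊g k y / s k⌋ = ⌊g k y' / s k⌋ := congrFun (hy.2.trans hy'.2.symm) k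
    have h2 := Int.abs_sub_lt_one_of_floor_eq_floor h1
    rw [← sub_div, abs_div, abs_of_pos (hs k), div_lt_one (hs k)] at h2
    exact h2.le
  calc (T.card : ℝ) = ∑ b ∈ P, (({y ∈ T | f y = b} : Finset α).card : ℝ) := by
        rw [Finset.card_eq_sum_card_fiberwise hmaps]
        push_cast
        rfl
    _ ≤ P.card * B := by
        rw [← nsmul_eq_mul]
        exact Finset.sum_le_card_nsmul _ _ _ hfib
    _ ≤ _ := by gcongr

/-- Between two boxes there is a box of any intermediate volume. -/
lemma exists_between_prod_eq {κ : Type*} [Fintype κ] {b a : κ → ℝ} (hba : ∀ k, b k ≤ a k) {c : ℝ}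
    (hb : ∏ k, b k ≤ c) (ha : c ≤ ∏ k, a k) :
    ∃ s : κ → ℝ, (∀ k, b k ≤ s k) ∧ (∀ k, s k ≤ a k) ∧ ∏ k, s k = c := by
  have hcont : ContinuousOn (fun t : ℝ => ∏ k, (b k + t * (a k - b k))) (Set.Icc 0 1) := by
    fun_prop
  obtain ⟨t, ht, htc⟩ := intermediate_value_Icc zero_le_one hcont
    (show c ∈ Set.Icc _ _ from ⟨by simpa using hb, by simpa using ha⟩)
  refine ⟨fun k => b k + t * (a k - b k), fun k => ?_, fun k => ?_, htc⟩
  · nlinarith [ht.1, hba k]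
  · nlinarith [ht.2, hba k]

lemma pos_of_prod_pos {κ : Type*} [Fintype κ] {s : κ → ℝ} (hs : ∀ k, 0 ≤ s k)
    (h : 0 < ∏ k, s k) (k : κ) : 0 < s k :=
  lt_of_le_of_ne (hs k) fun h0 => h.ne' (Finset.prod_eq_zero (Finset.mem_univ k) h0.symm)

variable {F : Type*} [Field F] [NumberField F] [IsTotallyReal F]

lemma prod_half_lt_one : ∏ _σ : F →+* ℝ, (1 / 2 : ℝ) < 1 := by
  rw [Finset.prod_const]
  exact pow_lt_one₀ (by norm_num) (by norm_num) (Finset.card_ne_zero.2 Finset.univ_nonempty)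

/-- Points whose images `(u, v)` in `𝓞 F × 𝓞 F` lie at every real place in a strip with sides `A`
and `b`, where every fibre has at most `B` points. -/
lemma card_le_of_strip {α : Type*} (T : Finset α) {K : ℝ} (hK : 1 ≤ K) {A b : (F →+* ℝ) → ℝ}
    (hb : ∀ σ, 0 < b σ) (hbA : ∀ σ, b σ ≤ A σ) (hA1 : 1 ≤ ∏ σ, A σ) (f g : (F →+* ℝ) → α → ℝ)
    (hf : ∀ y ∈ T, ∀ σ, |f σ y| ≤ A σ) (hg : ∀ y ∈ T, ∀ σ, |g σ y| ≤ b σ) (u v : α → 𝓞 F)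
    (hu : ∀ (σ : F →+* ℝ) (s : ℝ) (y y' : α), |f σ y - f σ y'| ≤ s → |g σ y - g σ y'| ≤ s →
      |σ ((u y - u y' : 𝓞 F) : F)| ≤ K * s)
    (hv : ∀ (σ : F →+* ℝ) (s : ℝ) (y y' : α), |f σ y - f σ y'| ≤ s → |g σ y - g σ y'| ≤ s →
      u y = u y' → |σ ((v y - v y' : 𝓞 F) : F)| ≤ K * s) {B : ℝ}
    (hB : ∀ T' ⊆ T, (∀ y ∈ T', ∀ y' ∈ T', u y = u y' ∧ v y = v y') → (T'.card : ℝ) ≤ B) :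
    (T.card : ℝ) ≤ (∏ _σ : F →+* ℝ, 64 * K ^ 2) * (∏ σ, A σ + (∏ σ, A σ) * ∏ σ, b σ) * B := by
  have hB0 : 0 ≤ B := by simpa using hB ∅ (Finset.empty_subset _) (by simp)
  have hA : ∀ σ, 0 < A σ := fun σ => (hb σ).trans_le (hbA σ)
  -- Cell sides with product `c` make the product of the `K * s σ` equal to `2⁻ᵈ < 1`, which
  -- separates integers.
  set c : ℝ := ∏ _σ : F →+* ℝ, 1 / (2 * K) with hc
  have hc0 : 0 < c := Finset.prod_pos fun _ _ => by positivity
  have hc1 : c ≤ 1 := by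
    refine Finset.prod_le_one (fun _ _ => by positivity) fun _ _ => ?_
    rw [div_le_one (by positivity)]
    linarith
  have hconst : (∏ _σ : F →+* ℝ, 64 * K ^ 2) = (∏ _σ : F →+* ℝ, 16) / c / c := by
    rw [hc, ← Finset.prod_div_distrib, ← Finset.prod_div_distrib]
    refine Finset.prod_congr rfl fun _ _ => ?_
    field_simp
    norm_num
  have key : ∀ s t : (F →+* ℝ) → ℝ, ∏ σ, s σ = c → (∀ σ, 0 < s σ) → (∀ σ, 0 < t σ) →
      (∀ σ, s σ ≤ A σ) → (∀ σ, t σ ≤ s σ) → (∀ σ, t σ ≤ b σ) →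
      (T.card : ℝ) ≤ ((∏ σ, 4 * (A σ / s σ)) * ∏ σ, 4 * (b σ / t σ)) * B := by
    intro s t hsc hs0 ht0 hsA hts htb
    have h1 := card_le_of_cells (κ := (F →+* ℝ) ⊕ (F →+* ℝ)) T (Sum.elim f g) (L := Sum.elim A b)
      (s := Sum.elim s t) (by rintro (σ | σ) <;> simp [hs0, ht0])
      (by rintro (σ | σ) <;> simp [hsA, htb]) (B := B)
      (by rintro y hy (σ | σ) <;> simp [hf y hy, hg y hy]) ?_
    · simpa [Fintype.prod_sum_type] using h1
    · intro T' hT' hcell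
      refine hB T' hT' fun y hy y' hy' => ?_
      have e1 : ∀ σ, |f σ y - f σ y'| ≤ s σ := fun σ => hcell y hy y' hy' (Sum.inl σ)
      have e2 : ∀ σ, |g σ y - g σ y'| ≤ s σ := fun σ =>
        (hcell y hy y' hy' (Sum.inr σ)).trans (hts σ)
      have e3 : ∏ σ, K * s σ < 1 := by
        rw [Finset.prod_mul_distrib, hsc, hc, ← Finset.prod_mul_distrib]
        convert prod_half_lt_one (F := F) using 2
        field_simp
      -- The coordinates are triangular: `v` is controlled only after `u` is known to agree.
      have e4 : u y = u y' :=
        sub_eq_zero.1 (eq_zero_of_prod_lt_one (fun σ => hu σ _ y y' (e1 σ) (e2 σ)) e3)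
      exact ⟨e4, sub_eq_zero.1
        (eq_zero_of_prod_lt_one (fun σ => hv σ _ y y' (e1 σ) (e2 σ) e4) e3)⟩
  have hAp : 0 < ∏ σ, A σ := Finset.prod_pos fun σ _ => hA σ
  have hbp : 0 < ∏ σ, b σ := Finset.prod_pos fun σ _ => hb σ
  have h16 : (∏ _σ : F →+* ℝ, (4 : ℝ)) * (∏ _σ : F →+* ℝ, (4 : ℝ)) = ∏ _σ : F →+* ℝ, (16 : ℝ) := by
    rw [← Finset.prod_mul_distrib]
    norm_num
  have h16p : 0 < ∏ _σ : F →+* ℝ, (16 : ℝ) := Finset.prod_pos fun _ _ => by norm_num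
  rw [hconst]
  -- A wide strip is cut in both directions, giving the term `A b`. A narrow one is cut only
  -- lengthwise, with `s` kept above `b`, giving the term `A`.
  rcases le_total c (∏ σ, b σ) with hcb | hcb
  · obtain ⟨s, hs0, hsb, hsc⟩ := exists_between_prod_eq (b := fun _ => 0) (a := b)
      (fun σ => (hb σ).le) (c := c) (by simp [hc0.le]) hcb
    have hs0' := pos_of_prod_pos hs0 (hsc ▸ hc0)
    refine (key s s hsc hs0' hs0' (fun σ => (hsb σ).trans (hbA σ)) (fun _ => le_rfl) hsb).trans
      (mul_le_mul_of_nonneg_right ?_ hB0)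
    rw [Finset.prod_mul_distrib, Finset.prod_mul_distrib, Finset.prod_div_distrib,
      Finset.prod_div_distrib, hsc, ← h16]
    calc _ = (∏ _σ : F →+* ℝ, (4 : ℝ)) * (∏ _σ : F →+* ℝ, (4 : ℝ)) / c / c *
          ((∏ σ, A σ) * ∏ σ, b σ) := by ring
      _ ≤ _ := by gcongr; linarith
  · obtain ⟨s, hbs, hsA, hsc⟩ := exists_between_prod_eq hbA hcb (hc1.trans hA1)
    have hs0' : ∀ σ, 0 < s σ := fun σ => (hb σ).trans_le (hbs σ)
    refine (key s b hsc hs0' hb hsA hbs (fun _ => le_rfl)).trans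
      (mul_le_mul_of_nonneg_right ?_ hB0)
    have h1 : ∀ σ, 4 * (b σ / b σ) = 4 := fun σ => by rw [div_self (hb σ).ne', mul_one]
    simp only [h1]
    rw [Finset.prod_mul_distrib, Finset.prod_div_distrib, hsc, ← h16]
    calc _ = (∏ _σ : F →+* ℝ, (4 : ℝ)) * (∏ _σ : F →+* ℝ, (4 : ℝ)) / c * (∏ σ, A σ) := by ring
      _ ≤ (∏ _σ : F →+* ℝ, (4 : ℝ)) * (∏ _σ : F →+* ℝ, (4 : ℝ)) / c / c * (∏ σ, A σ) := by
        gcongr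
        rw [h16]
        exact le_div_self (by positivity) hc0 hc1
      _ ≤ _ := by
        gcongr
        have : 0 < (∏ σ, A σ) * ∏ σ, b σ := by positivity
        linarith

end Cells

/-! ### Gram determinants in orthonormal coordinates -/

section Frame

lemma abs_det_three_le {x y z : Fin 3 → ℝ} {X Y Z : ℝ} (hx : ∀ i, |x i| ≤ X) (hy : ∀ i, |y i| ≤ Y)
    (hz : ∀ i, |z i| ≤ Z) : |x 0 * (y 1 * z 2 - y 2 * z 1) + x 1 * (y 2 * z 0 - y 0 * z 2) +
      x 2 * (y 0 * z 1 - y 1 * z 0)| ≤ 6 * (X * Y * Z) := by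
  have hY : 0 ≤ Y := (abs_nonneg _).trans (hy 0)
  have hX : 0 ≤ X := (abs_nonneg _).trans (hx 0)
  have h2 : ∀ i j, |y i * z j| ≤ Y * Z := fun i j => by
    rw [abs_mul]
    exact mul_le_mul (hy i) (hz j) (abs_nonneg _) hY
  have h3 : ∀ i j, |y i * z j - y j * z i| ≤ 2 * (Y * Z) := fun i j =>
    (abs_sub _ _).trans (by linarith [h2 i j, h2 j i])
  have h4 : ∀ k i j, |x k * (y i * z j - y j * z i)| ≤ X * (2 * (Y * Z)) := fun k i j => by
    rw [abs_mul]
    exact mul_le_mul (hx k) (h3 i j) (abs_nonneg _) hX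
  refine (abs_add_three _ _ _).trans ?_
  linarith [h4 0 1 2, h4 1 2 0, h4 2 0 1]

variable {F V : Type*} [Field F] [AddCommGroup V] [Module (𝓞 F) V]

/-- Orthonormal coordinates `φ` for the conjugate of `Q` at the embedding `σ`. -/
def IsFrame (Q : QuadraticForm (𝓞 F) V) (σ : F →+* ℝ) (φ : Fin 4 → V →+ ℝ) : Prop :=
  ∀ y, σ (Q y : F) = ∑ i, φ i y ^ 2

lemma IsFrame.polar {Q : QuadraticForm (𝓞 F) V} {σ : F →+* ℝ} {φ : Fin 4 → V →+ ℝ}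
    (h : IsFrame Q σ φ) (y z : V) :
    σ ((QuadraticMap.polar Q y z : 𝓞 F) : F) = 2 * ∑ i, φ i y * φ i z := by
  have h1 : σ ((QuadraticMap.polar Q y z : 𝓞 F) : F) =
      σ (Q (y + z) : F) - σ (Q y : F) - σ (Q z : F) := by
    simp [QuadraticMap.polar]
  rw [h1, h, h, h]
  simp only [map_add, Fin.sum_univ_four]
  ring

/-- Cauchy–Binet: `gram₃` is four times the sum of the squares of the four `3 × 3` minors. Each
minor involves coordinate 0 or 1 and is at most `48 β s A`; and `4 · 4 · 48² = 192²`. -/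
lemma IsFrame.abs_gram₃_le [NumberField F] {Q : QuadraticForm (𝓞 F) V} {σ : F →+* ℝ}
    {φ : Fin 4 → V →+ ℝ} (h : IsFrame Q σ φ) {β s A : ℝ} (hβs : β ≤ s) (hsA : s ≤ A)
    {v : Fin 3 → V} (h0 : ∀ i, |φ 0 (v i)| ≤ 2 * β) (h1 : ∀ i, |φ 1 (v i)| ≤ 2 * β)
    (h2 : ∀ i, |φ 2 (v i)| ≤ s) (h3 : ∀ i, |φ 3 (v i)| ≤ 2 * A) :
    |σ ((gram₃ Q (v 0) (v 1) (v 2) : 𝓞 F) : F)| ≤ (192 * (β * s * A)) ^ 2 := by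
  have hβ : 0 ≤ β := by linarith [(abs_nonneg _).trans (h0 0)]
  have m1 := abs_det_three_le (x := fun i => φ 0 (v i)) (y := fun i => φ 1 (v i))
    (z := fun i => φ 2 (v i)) h0 h1 h2
  have m2 := abs_det_three_le (x := fun i => φ 0 (v i)) (y := fun i => φ 1 (v i))
    (z := fun i => φ 3 (v i)) h0 h1 h3
  have m3 := abs_det_three_le (x := fun i => φ 0 (v i)) (y := fun i => φ 2 (v i))
    (z := fun i => φ 3 (v i)) h0 h2 h3
  have m4 := abs_det_three_le (x := fun i => φ 1 (v i)) (y := fun i => φ 2 (v i))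
    (z := fun i => φ 3 (v i)) h1 h2 h3
  have hs : 0 ≤ s := hβ.trans hβs
  have hA : 0 ≤ A := hs.trans hsA
  have b1 : 6 * (2 * β * (2 * β) * s) ≤ 48 * (β * s * A) := by
    have : β * s * β ≤ β * s * A := by gcongr; linarith
    nlinarith [mul_nonneg (mul_nonneg hβ hs) hA]
  have b2 : 6 * (2 * β * (2 * β) * (2 * A)) ≤ 48 * (β * s * A) := by
    have : β * β * A ≤ β * s * A := by gcongr
    linarith
  have b3 : 6 * (2 * β * s * (2 * A)) ≤ 48 * (β * s * A) := by
    nlinarith [mul_nonneg (mul_nonneg hβ hs) hA]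
  have q1 := sq_le_sq' (abs_le.1 (m1.trans b1)).1 (abs_le.1 (m1.trans b1)).2
  have q2 := sq_le_sq' (abs_le.1 (m2.trans b2)).1 (abs_le.1 (m2.trans b2)).2
  have q3 := sq_le_sq' (abs_le.1 (m3.trans b3)).1 (abs_le.1 (m3.trans b3)).2
  have q4 := sq_le_sq' (abs_le.1 (m4.trans b3)).1 (abs_le.1 (m4.trans b3)).2
  have e : σ ((gram₃ Q (v 0) (v 1) (v 2) : 𝓞 F) : F) =
      4 * σ (Q (v 0) : F) * σ (Q (v 1) : F) * σ (Q (v 2) : F) +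
      σ ((QuadraticMap.polar Q (v 0) (v 1) : 𝓞 F) : F) *
        σ ((QuadraticMap.polar Q (v 1) (v 2) : 𝓞 F) : F) *
        σ ((QuadraticMap.polar Q (v 0) (v 2) : 𝓞 F) : F) -
      σ (Q (v 0) : F) * σ ((QuadraticMap.polar Q (v 1) (v 2) : 𝓞 F) : F) ^ 2 -
      σ (Q (v 1) : F) * σ ((QuadraticMap.polar Q (v 0) (v 2) : 𝓞 F) : F) ^ 2 -
      σ (Q (v 2) : F) * σ ((QuadraticMap.polar Q (v 0) (v 1) : 𝓞 F) : F) ^ 2 := by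
    simp only [gram₃, map_sub, map_add, map_mul, map_pow]
    rw [embedding_ofNat]
  simp only [h _, h.polar, Fin.sum_univ_four] at e
  rw [e]
  generalize φ 0 (v 0) = x0 at *
  generalize φ 0 (v 1) = x1 at *
  generalize φ 0 (v 2) = x2 at *
  generalize φ 1 (v 0) = y0 at *
  generalize φ 1 (v 1) = y1 at *
  generalize φ 1 (v 2) = y2 at *
  generalize φ 2 (v 0) = z0 at *
  generalize φ 2 (v 1) = z1 at *
  generalize φ 2 (v 2) = z2 at *
  generalize φ 3 (v 0) = w0 at *
  generalize φ 3 (v 1) = w1 at *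
  generalize φ 3 (v 2) = w2 at *
  set n1 := x0 * (y1 * z2 - y2 * z1) + x1 * (y2 * z0 - y0 * z2) + x2 * (y0 * z1 - y1 * z0) with hn1
  set n2 := x0 * (y1 * w2 - y2 * w1) + x1 * (y2 * w0 - y0 * w2) + x2 * (y0 * w1 - y1 * w0) with hn2
  set n3 := x0 * (z1 * w2 - z2 * w1) + x1 * (z2 * w0 - z0 * w2) + x2 * (z0 * w1 - z1 * w0) with hn3
  set n4 := y0 * (z1 * w2 - z2 * w1) + y1 * (z2 * w0 - z0 * w2) + y2 * (z0 * w1 - z1 * w0) with hn4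
  have hid : 4 * (x0 ^ 2 + y0 ^ 2 + z0 ^ 2 + w0 ^ 2) * (x1 ^ 2 + y1 ^ 2 + z1 ^ 2 + w1 ^ 2) *
      (x2 ^ 2 + y2 ^ 2 + z2 ^ 2 + w2 ^ 2) +
      2 * (x0 * x1 + y0 * y1 + z0 * z1 + w0 * w1) * (2 * (x1 * x2 + y1 * y2 + z1 * z2 + w1 * w2)) *
        (2 * (x0 * x2 + y0 * y2 + z0 * z2 + w0 * w2)) -
      (x0 ^ 2 + y0 ^ 2 + z0 ^ 2 + w0 ^ 2) * (2 * (x1 * x2 + y1 * y2 + z1 * z2 + w1 * w2)) ^ 2 -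
      (x1 ^ 2 + y1 ^ 2 + z1 ^ 2 + w1 ^ 2) * (2 * (x0 * x2 + y0 * y2 + z0 * z2 + w0 * w2)) ^ 2 -
      (x2 ^ 2 + y2 ^ 2 + z2 ^ 2 + w2 ^ 2) * (2 * (x0 * x1 + y0 * y1 + z0 * z1 + w0 * w1)) ^ 2 =
      4 * (n1 ^ 2 + n2 ^ 2 + n3 ^ 2 + n4 ^ 2) := by
    rw [hn1, hn2, hn3, hn4]
    ring
  rw [hid, abs_of_nonneg (by positivity)]
  linarith

end Frame

/-- Points on the quadric `Q = l` that are close to a plane at every real place: subdividing along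
one direction of the plane produces coplanar cells. -/
lemma exists_card_near_plane_le (F : Type*) [Field F] [NumberField F] [IsTotallyReal F] {ε : ℝ}
    (hε : 0 < ε) : ∃ C : ℝ, 0 < C ∧ ∀ (V : Type*) [AddCommGroup V] [Module (𝓞 F) V]
      (Q : QuadraticForm (𝓞 F) V), (∀ y : V, y ≠ 0 → ∀ σ : F →+* ℝ, 0 < σ (Q y : F)) →
      ∀ φ : (F →+* ℝ) → Fin 4 → V →+ ℝ, (∀ σ, IsFrame Q σ (φ σ)) →
      ∀ l : 𝓞 F, l ≠ 0 → ∀ β A : (F →+* ℝ) → ℝ, (∀ σ, 0 < β σ) → (∀ σ, β σ ≤ A σ) →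
      (∏ σ, β σ) * ∏ σ, 384 * (β σ * A σ) ≤ 1 → ∀ T : Finset V, (∀ y ∈ T, Q y = l) →
      (∀ y ∈ T, ∀ σ, |φ σ 0 y| ≤ β σ ∧ |φ σ 1 y| ≤ β σ ∧ |φ σ 2 y| ≤ A σ ∧ |φ σ 3 y| ≤ A σ) →
        (T.card : ℝ) ≤ C * (1 + (∏ σ, A σ) * ∏ σ, β σ * A σ) * nrm l ^ ε := by
  obtain ⟨C, hC, hcop⟩ := exists_card_coplanar_le F hε
  set K : ℝ := ∏ _σ : F →+* ℝ, (384 : ℝ) with hK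
  set E : ℝ := ∏ _σ : F →+* ℝ, (4 : ℝ) with hE
  have hK1 : 1 ≤ K := Finset.one_le_prod fun _ => by norm_num
  have hE1 : 1 ≤ E := Finset.one_le_prod fun _ => by norm_num
  refine ⟨E * K * C, by positivity, fun V _ _ Q hQ φ hφ l hl β A hβ hβA hsmall T hT hbound => ?_⟩
  have hA : ∀ σ, 0 < A σ := fun σ => (hβ σ).trans_le (hβA σ)
  have hl0 := nrm_nonneg l
  set m : ℝ := ∏ σ, β σ * A σ with hm
  have hm0 : 0 < m := Finset.prod_pos fun σ _ => mul_pos (hβ σ) (hA σ)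
  have hA0 : 0 < ∏ σ, A σ := Finset.prod_pos fun σ _ => hA σ
  rw [Finset.prod_mul_distrib, ← hK, ← hm] at hsmall
  -- Since `384 = 2 · 192`, the condition leaves a factor `1 / 2` at each place; the Gram
  -- determinants in a cell then have norm below 1, so every cell is coplanar.
  have key : ∀ s : (F →+* ℝ) → ℝ, (∀ σ, β σ ≤ s σ) → (∀ σ, s σ ≤ A σ) →
      K * m * ∏ σ, s σ ≤ 1 → (T.card : ℝ) ≤ (∏ σ, 4 * (A σ / s σ)) * (C * nrm l ^ ε) := by
    intro s hβs hsA hsm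
    refine card_le_of_cells T (fun σ => φ σ 2) (fun σ => (hβ σ).trans_le (hβs σ)) hsA
      (fun y hy σ => (hbound y hy σ).2.2.1) fun T' hT' hcell => ?_
    refine hcop V Q hQ l hl T' (fun y hy => hT y (hT' hy)) fun y₀ h₀ y₁ h₁ y₂ h₂ y₃ h₃ => ?_
    have hmem : ∀ i, ![y₁, y₂, y₃] i ∈ T' := by
      intro i
      fin_cases i <;> simpa
    have hdiff : ∀ (σ : F →+* ℝ) (j : Fin 4) (x : ℝ), (∀ y ∈ T, |φ σ j y| ≤ x) →
        ∀ i, |φ σ j (![y₁, y₂, y₃] i - y₀)| ≤ 2 * x := fun σ j x h i => by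
      rw [map_sub]
      refine (abs_sub _ _).trans ?_
      linarith [h _ (hT' (hmem i)), h _ (hT' h₀)]
    have hg : ∀ σ, |σ ((gram₃ Q (y₁ - y₀) (y₂ - y₀) (y₃ - y₀) : 𝓞 F) : F)| ≤
        (192 * (β σ * s σ * A σ)) ^ 2 := fun σ =>
      (hφ σ).abs_gram₃_le (v := fun i => ![y₁, y₂, y₃] i - y₀) (hβs σ) (hsA σ)
        (hdiff σ 0 _ fun y hy => (hbound y hy σ).1) (hdiff σ 1 _ fun y hy => (hbound y hy σ).2.1)
        (fun i => by rw [map_sub]; exact hcell _ (hmem i) _ h₀ σ)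
        (hdiff σ 3 _ fun y hy => (hbound y hy σ).2.2.2)
    refine eq_zero_of_prod_lt_one hg ?_
    rw [Finset.prod_pow]
    have h1 : ∏ σ, 192 * (β σ * s σ * A σ) ≤ ∏ _σ : F →+* ℝ, (1 / 2 : ℝ) := by
      calc ∏ σ, 192 * (β σ * s σ * A σ) = ∏ σ, (1 / 2) * (384 * (β σ * A σ) * s σ) :=
            Finset.prod_congr rfl fun _ _ => by ring
        _ = (∏ _σ : F →+* ℝ, (1 / 2 : ℝ)) * (K * m * ∏ σ, s σ) := by
            rw [Finset.prod_mul_distrib, Finset.prod_mul_distrib, Finset.prod_mul_distrib]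
        _ ≤ _ := mul_le_of_le_one_right (Finset.prod_nonneg fun _ _ => by norm_num) hsm
    have h0 : 0 ≤ ∏ σ, 192 * (β σ * s σ * A σ) := Finset.prod_nonneg fun σ _ => by
      have := (hβ σ).le
      have := (hA σ).le
      have := (hβ σ).le.trans (hβs σ)
      positivity
    exact pow_lt_one₀ h0 (h1.trans_lt prod_half_lt_one) two_ne_zero
  -- Cells as large as allowed, with product of sides `1 / (K m)`; if this exceeds the whole range,
  -- the number of cells is bounded by a constant.
  rcases le_total (1 / (K * m)) (∏ σ, A σ) with h | h
  · have h1 : ∏ σ, β σ ≤ 1 / (K * m) := by rwa [le_div_iff₀ (by positivity)]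
    obtain ⟨s, hβs, hsA, hsc⟩ := exists_between_prod_eq hβA h1 h
    refine (key s hβs hsA ?_).trans ?_
    · rw [hsc, mul_one_div_cancel (by positivity)]
    · rw [Finset.prod_mul_distrib, ← hE, Finset.prod_div_distrib, hsc]
      calc E * ((∏ σ, A σ) / (1 / (K * m))) * (C * nrm l ^ ε) =
          E * K * C * ((∏ σ, A σ) * m) * nrm l ^ ε := by
            field_simp
        _ ≤ _ := by gcongr; linarith
  · refine (key A hβA (fun _ => le_rfl) ?_).trans ?_
    · rwa [le_div_iff₀ (by positivity), mul_comm] at h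
    · have h1 : ∀ σ, 4 * (A σ / A σ) = 4 := fun σ => by rw [div_self (hA σ).ne', mul_one]
      simp only [h1]
      rw [← hE]
      calc E * (C * nrm l ^ ε) = E * 1 * C * 1 * nrm l ^ ε := by ring
        _ ≤ _ := by
          gcongr
          have : 0 < (∏ σ, A σ) * m := by positivity
          linarith

/-! ### Integral forms and their real diagonalizations -/

section Forms

lemma gramMatrix_symm {F : Type*} [Field F] {n : ℕ} (Q : QuadraticForm (𝓞 F) (Fin n → 𝓞 F))
    (i j : Fin n) : gramMatrix Q i j = gramMatrix Q j i := QuadraticMap.polar_comm _ _ _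

lemma polar_eq_sum {F : Type*} [Field F] {n : ℕ} (Q : QuadraticForm (𝓞 F) (Fin n → 𝓞 F))
    (y z : Fin n → 𝓞 F) :
    QuadraticMap.polar Q y z = ∑ i, ∑ j, gramMatrix Q i j * y i * z j := by
  rw [← QuadraticMap.polarBilin_apply_apply]
  conv_lhs => rw [pi_eq_sum_univ' y, pi_eq_sum_univ' z]
  simp only [map_sum, LinearMap.sum_apply, map_smul, LinearMap.smul_apply, smul_eq_mul,
    QuadraticMap.polarBilin_apply_apply]
  rw [Finset.sum_comm]
  refine Finset.sum_congr rfl fun i _ => ?_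
  rw [Finset.mul_sum]
  refine Finset.sum_congr rfl fun j _ => ?_
  rw [show QuadraticMap.polar Q (Pi.single j 1) (Pi.single i 1) = gramMatrix Q j i from rfl]
  ring

lemma conj_vecConj {F : Type*} [Field F] {n : ℕ} (Q : QuadraticForm (𝓞 F) (Fin n → 𝓞 F))
    (σ : F →+* ℝ) (y : Fin n → 𝓞 F) : conj Q σ (vecConj σ y) = σ (Q y : F) := by
  have h1 : ∑ i, ∑ j, gramMatrix Q i j * y i * y j = Q y + Q y := by
    rw [← polar_eq_sum, QuadraticMap.polar_self, two_smul]
  have h2 := congrArg (fun a : 𝓞 F => σ (a : F)) h1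
  simp only [map_sum, map_mul, map_add] at h2
  rw [conj, bil]
  simp only [vecConj]
  rw [h2]
  ring

lemma embedding_map_pos {F : Type*} [Field F] {n : ℕ} {Q : QuadraticForm (𝓞 F) (Fin n → 𝓞 F)}
    (hQ : TotPosDef Q) (y : Fin n → 𝓞 F) (hy : y ≠ 0) (σ : F →+* ℝ) : 0 < σ (Q y : F) := by
  rw [← conj_vecConj]
  refine hQ σ _ fun h => hy (funext fun i => ?_)
  have := congrFun h i
  simpa [vecConj] using this

lemma disc_ne_zero {F : Type*} [Field F] [Nonempty (F →+* ℝ)] {n : ℕ}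
    {Q : QuadraticForm (𝓞 F) (Fin n → 𝓞 F)} (hQ : TotPosDef Q) : disc Q ≠ 0 := by
  intro h
  obtain ⟨v, hv, hv0⟩ := Matrix.exists_mulVec_eq_zero_iff.2 h
  have h1 := embedding_map_pos hQ v hv (Classical.arbitrary _)
  have h2 : Q v + Q v = 0 := by
    have h3 : QuadraticMap.polar Q v v = 0 := by
      rw [polar_eq_sum]
      refine Finset.sum_eq_zero fun i _ => ?_
      have h4 := congrFun hv0 i
      simp only [Matrix.mulVec, dotProduct, Pi.zero_apply] at h4
      calc _ = (∑ j, gramMatrix Q i j * v j) * v i := by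
            rw [Finset.sum_mul]
            exact Finset.sum_congr rfl fun j _ => by ring
        _ = 0 := by rw [h4, zero_mul]
    rwa [QuadraticMap.polar_self, two_smul] at h3
  have h5 : (Classical.arbitrary (F →+* ℝ)) ((Q v + Q v : 𝓞 F) : F) = 0 := by rw [h2]; simp
  simp only [map_add] at h5
  linarith

/-- The real coordinates attached to a diagonalization of a ternary form. -/
structure Diagonalization {F : Type*} [Field F] (M : ℝ) (Q : QuadraticForm (𝓞 F) (Fin 3 → 𝓞 F)) where
  /-- the coordinates -/
  L : (F →+* ℝ) → Fin 3 → (Fin 3 → ℝ) →ₗ[ℝ] ℝ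
  /-- the diagonal coefficients -/
  r : (F →+* ℝ) → Fin 3 → ℝ
  bil_eq : ∀ σ x y, bil Q σ x y = ∑ k, L σ k x * L σ k y
  L_two : ∀ σ x, L σ 2 x = r σ 2 * x 2
  L_one : ∀ σ x, x 2 = 0 → L σ 1 x = r σ 1 * x 1
  one_le : ∀ σ k, 1 ≤ M * r σ k ^ 2

/-- The diagonalization is given only at points over `F`. Evaluating at `e_i` and `e_i + e_j`
identifies the coefficients, which can then be conjugated and used with real variables. -/
lemma conj_eq_of_diag {F : Type*} [Field F] [NumberField F] [Nonempty (F →+* ℝ)]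
    {Q : QuadraticForm (𝓞 F) (Fin 3 → 𝓞 F)} {h : Fin 3 → F} {c : Fin 3 → Fin 3 → F}
    (hc : ∀ x : Fin 3 → F, conj Q (RingHom.id F) x =
      ∑ i, h i * (x i + ∑ j ∈ Finset.Ioi i, c i j * x j) ^ 2) (σ : F →+* ℝ) (x y : Fin 3 → ℝ) :
    bil Q σ x y = σ (h 0) * (x 0 + σ (c 0 1) * x 1 + σ (c 0 2) * x 2) *
        (y 0 + σ (c 0 1) * y 1 + σ (c 0 2) * y 2) +
      σ (h 1) * (x 1 + σ (c 1 2) * x 2) * (y 1 + σ (c 1 2) * y 2) + σ (h 2) * x 2 * y 2 := by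
  have i0 : Finset.Ioi (0 : Fin 3) = {1, 2} := by decide
  have i1 : Finset.Ioi (1 : Fin 3) = {2} := by decide
  have i2 : Finset.Ioi (2 : Fin 3) = ∅ := by decide
  have key : ∀ x0 x1 x2 : F, (1 / 2) * ((gramMatrix Q 0 0 : F) * x0 ^ 2 +
      (gramMatrix Q 1 1 : F) * x1 ^ 2 + (gramMatrix Q 2 2 : F) * x2 ^ 2 +
      2 * (gramMatrix Q 0 1 : F) * x0 * x1 + 2 * (gramMatrix Q 0 2 : F) * x0 * x2 +
      2 * (gramMatrix Q 1 2 : F) * x1 * x2) =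
      h 0 * (x0 + c 0 1 * x1 + c 0 2 * x2) ^ 2 + h 1 * (x1 + c 1 2 * x2) ^ 2 + h 2 * x2 ^ 2 := by
    intro x0 x1 x2
    have h1 := hc ![x0, x1, x2]
    simp only [conj, bil, Fin.sum_univ_three, i0, i1, i2, RingHom.id_apply] at h1
    rw [gramMatrix_symm Q 1 0, gramMatrix_symm Q 2 0, gramMatrix_symm Q 2 1] at h1
    simp at h1
    linear_combination h1
  have e00 : (gramMatrix Q 0 0 : F) = 2 * h 0 := by linear_combination 2 * key 1 0 0
  have e11 : (gramMatrix Q 1 1 : F) = 2 * (h 0 * c 0 1 ^ 2 + h 1) := by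
    linear_combination 2 * key 0 1 0
  have e22 : (gramMatrix Q 2 2 : F) = 2 * (h 0 * c 0 2 ^ 2 + h 1 * c 1 2 ^ 2 + h 2) := by
    linear_combination 2 * key 0 0 1
  have e01 : (gramMatrix Q 0 1 : F) = 2 * (h 0 * c 0 1) := by
    linear_combination key 1 1 0 - key 1 0 0 - key 0 1 0
  have e02 : (gramMatrix Q 0 2 : F) = 2 * (h 0 * c 0 2) := by
    linear_combination key 1 0 1 - key 1 0 0 - key 0 0 1
  have e12 : (gramMatrix Q 1 2 : F) = 2 * (h 0 * c 0 1 * c 0 2 + h 1 * c 1 2) := by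
    linear_combination key 0 1 1 - key 0 1 0 - key 0 0 1
  simp only [bil, Fin.sum_univ_three]
  rw [gramMatrix_symm Q 1 0, gramMatrix_symm Q 2 0, gramMatrix_symm Q 2 1, e00, e11, e22, e01, e02,
    e12]
  simp only [map_mul, map_add, map_pow, map_ofNat]
  ring

lemma TotPosDef.of_tail {F : Type*} [Field F] {Q : QuadraticForm (𝓞 F) (Fin 4 → 𝓞 F)}
    {Qt : QuadraticForm (𝓞 F) (Fin 3 → 𝓞 F)}
    (hQ : ∀ y : Fin 4 → 𝓞 F, Q y = y 0 ^ 2 + Qt (Fin.tail y)) (hpos : TotPosDef Q) :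
    TotPosDef Qt := by
  intro σ x hx
  have htail : ∀ i : Fin 3, Fin.tail (Pi.single i.succ 1 : Fin 4 → 𝓞 F) = Pi.single i 1 := by
    intro i
    ext j
    simp [Fin.tail, Pi.single_apply]
  have h1 : ∀ i j : Fin 3, gramMatrix Q i.succ j.succ = gramMatrix Qt i j := by
    intro i j
    have h0 : ∀ k : Fin 3, (Pi.single k.succ 1 : Fin 4 → 𝓞 F) 0 = 0 := fun k => by
      simp
    have h2 : Fin.tail (Pi.single i.succ 1 + Pi.single j.succ 1 : Fin 4 → 𝓞 F) =
        Pi.single i 1 + Pi.single j 1 := by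
      rw [← htail i, ← htail j]
      rfl
    simp only [gramMatrix, Matrix.of_apply, QuadraticMap.polar, hQ, h2, htail, Pi.add_apply, h0]
    ring
  have h2 : conj Q σ (Fin.cons 0 x) = conj Qt σ x := by
    simp only [conj, bil]
    rw [Fin.sum_univ_succ]
    simp only [Fin.sum_univ_succ (n := 3), Fin.cons_zero, Fin.cons_succ, h1]
    simp
  rw [← h2]
  refine hpos σ _ fun h => hx (funext fun i => ?_)
  exact congrFun h i.succ

/-- A reduced positive definite ternary form has diagonalizing real coordinates. -/
lemma IsReduced.diagonalization {F : Type*} [Field F] [NumberField F] [Nonempty (F →+* ℝ)] {M : ℝ}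
    {Q : QuadraticForm (𝓞 F) (Fin 3 → 𝓞 F)} (hQ : IsReduced M Q) (hpos : TotPosDef Q) :
    Nonempty (Diagonalization M Q) := by
  obtain ⟨h, c, hc, -, -, hM, -⟩ := hQ
  have hbil := conj_eq_of_diag hc
  -- For each `k`, test the form on a vector killing the other two linear forms.
  have hh : ∀ (σ : F →+* ℝ) (k : Fin 3), 0 < σ (h k) := by
    intro σ k
    fin_cases k
    · have := hpos σ ![1, 0, 0] (fun h => by simpa using congrFun h 0)
      rw [conj, hbil] at this
      simpa using this
    · have := hpos σ ![-σ (c 0 1), 1, 0] (fun h => by simpa using congrFun h 1)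
      rw [conj, hbil] at this
      simpa using this
    · have := hpos σ ![σ (c 0 1) * σ (c 1 2) - σ (c 0 2), -σ (c 1 2), 1]
        (fun h => by simpa using congrFun h 2)
      rw [conj, hbil] at this
      simp only [Matrix.cons_val_zero, Matrix.cons_val_one, Matrix.cons_val] at this
      change 0 < σ (h 2)
      linarith
  let p : Fin 3 → (Fin 3 → ℝ) →ₗ[ℝ] ℝ := fun k => LinearMap.proj k
  refine ⟨⟨fun σ => ![√(σ (h 0)) • (p 0 + σ (c 0 1) • p 1 + σ (c 0 2) • p 2),
    √(σ (h 1)) • (p 1 + σ (c 1 2) • p 2), √(σ (h 2)) • p 2], fun σ k => √(σ (h k)), ?_, ?_, ?_, ?_⟩⟩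
  · intro σ x y
    rw [hbil]
    have e0 := Real.mul_self_sqrt (hh σ 0).le
    have e1 := Real.mul_self_sqrt (hh σ 1).le
    have e2 := Real.mul_self_sqrt (hh σ 2).le
    simp only [Fin.sum_univ_three, Matrix.cons_val_zero, Matrix.cons_val_one, Matrix.cons_val,
      LinearMap.smul_apply, LinearMap.add_apply, p, LinearMap.proj_apply, smul_eq_mul]
    linear_combination
      (-(x 0 + σ (c 0 1) * x 1 + σ (c 0 2) * x 2) * (y 0 + σ (c 0 1) * y 1 + σ (c 0 2) * y 2)) * e0 -
      (x 1 + σ (c 1 2) * x 2) * (y 1 + σ (c 1 2) * y 2) * e1 - x 2 * y 2 * e2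
  · intro σ x
    simp [p]
  · intro σ x hx
    simp [p, hx]
  · intro σ k
    rw [Real.sq_sqrt (hh σ k).le]
    exact hM σ k

end Forms

/-! ### Rotations of real coordinates -/

section Rotation

/-- A unit vector of `ℝ³` is the first vector of an orthonormal basis. -/
lemma exists_orthonormal_extension {ξ : Fin 3 → ℝ} (hξ : ∑ k, ξ k ^ 2 = 1) :
    ∃ a b : Fin 3 → ℝ, ∀ v : Fin 3 → ℝ, ∑ k, v k ^ 2 =
      (∑ k, v k * ξ k) ^ 2 + (∑ k, v k * a k) ^ 2 + (∑ k, v k * b k) ^ 2 := by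
  let w : EuclideanSpace ℝ (Fin 3) := WithLp.toLp 2 ξ
  have hw : ‖w‖ = 1 := by
    rw [EuclideanSpace.norm_eq, Real.sqrt_eq_one]
    simpa [w] using hξ
  obtain ⟨e, he⟩ := Orthonormal.exists_orthonormalBasis_extension_of_card_eq (𝕜 := ℝ)
    (E := EuclideanSpace ℝ (Fin 3)) (ι := Fin 3) (by simp) (v := fun _ => w) (s := {0})
    ⟨fun _ => hw, fun i j hij => (hij (Subsingleton.elim i j)).elim⟩
  have he0 : e 0 = w := he 0 rfl
  refine ⟨fun k => e 1 k, fun k => e 2 k, fun v => ?_⟩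
  have h1 := e.sum_sq_norm_inner_right (WithLp.toLp 2 v)
  have h2 : ∀ u : EuclideanSpace ℝ (Fin 3),
      ‖inner ℝ u (WithLp.toLp 2 v)‖ ^ 2 = (∑ k, v k * u k) ^ 2 := fun u => by
    rw [Real.norm_eq_abs, sq_abs, PiLp.inner_apply]
    simp
  simp only [h2, Fin.sum_univ_three (fun i => (∑ k, v k * e i k) ^ 2), he0] at h1
  rw [EuclideanSpace.norm_sq_eq] at h1
  simp only [Real.norm_eq_abs, sq_abs] at h1
  exact h1.symm

/-- The unit vector along `(p, q)`, or an arbitrary one if `(p, q)` vanishes. -/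
lemma exists_unit_normal (p q : ℝ) : ∃ a b : ℝ, a ^ 2 + b ^ 2 = 1 ∧ a * q - b * p = 0 := by
  by_cases h : p ^ 2 + q ^ 2 = 0
  · have hp : p = 0 := by nlinarith [sq_nonneg p, sq_nonneg q]
    have hq : q = 0 := by nlinarith [sq_nonneg p, sq_nonneg q]
    exact ⟨1, 0, by norm_num, by simp [hp, hq]⟩
  · have h0 : 0 < p ^ 2 + q ^ 2 := lt_of_le_of_ne (by positivity) (Ne.symm h)
    have h1 : √(p ^ 2 + q ^ 2) ≠ 0 := (Real.sqrt_pos.2 h0).ne'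
    refine ⟨p / √(p ^ 2 + q ^ 2), q / √(p ^ 2 + q ^ 2), ?_, by field_simp; ring⟩
    rw [div_pow, div_pow, Real.sq_sqrt h0.le, ← add_div, div_self h]

end Rotation

/-! ### Combining the strip and plane bounds -/

section Combination

lemma prod_sqrt {κ : Type*} [Fintype κ] {f : κ → ℝ} (hf : ∀ k, 0 ≤ f k) :
    ∏ k, √(f k) = √(∏ k, f k) := by
  simp only [Real.sqrt_eq_rpow]
  exact Real.finsetProd_rpow _ _ (fun k _ => hf k) _

/-- The two counting bounds for points on a quaternary quadric near a plane whose projection to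
some coordinate plane lies in a strip; here `a = N(l) ^ (1/2)` and `h = N(η) ^ (1/2)`. -/
lemma exists_card_le_strip_and_plane (F : Type*) [Field F] [NumberField F] [IsTotallyReal F]
    {ε K : ℝ} (hε : 0 < ε) (hK : 1 ≤ K) : ∃ C : ℝ, 0 < C ∧ ∀ (V : Type*) [AddCommGroup V]
      [Module (𝓞 F) V] (Q : QuadraticForm (𝓞 F) V),
      (∀ y : V, y ≠ 0 → ∀ σ : F →+* ℝ, 0 < σ (Q y : F)) →
      ∀ φ : (F →+* ℝ) → Fin 4 → V →+ ℝ, (∀ σ, IsFrame Q σ (φ σ)) →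
      ∀ l : 𝓞 F, l ≠ 0 → (∀ σ : F →+* ℝ, 0 < σ (l : F)) →
      ∀ η : (F →+* ℝ) → ℝ, (∀ σ, 0 < η σ ∧ η σ ≤ 1) →
      ∀ T : Finset V, (∀ y ∈ T, Q y = l) →
      (∀ y ∈ T, ∀ σ, φ σ 0 y ^ 2 + φ σ 1 y ^ 2 ≤ η σ * σ (l : F)) →
      ∀ f g : (F →+* ℝ) → V → ℝ, (∀ y ∈ T, ∀ σ, f σ y ^ 2 ≤ σ (l : F)) →
      (∀ y ∈ T, ∀ σ, g σ y ^ 2 ≤ η σ * σ (l : F)) → ∀ u v : V →+ 𝓞 F,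
      (∀ (σ : F →+* ℝ) (s : ℝ) (y y' : V), |f σ y - f σ y'| ≤ s → |g σ y - g σ y'| ≤ s →
        |σ ((u y - u y' : 𝓞 F) : F)| ≤ K * s) →
      (∀ (σ : F →+* ℝ) (s : ℝ) (y y' : V), |f σ y - f σ y'| ≤ s → |g σ y - g σ y'| ≤ s →
        u y = u y' → |σ ((v y - v y' : 𝓞 F) : F)| ≤ K * s) →
      ∀ e e' : V, (∀ y, u y = 0 → v y = 0 → ∃ a a' : 𝓞 F, y = a • e + a' • e') →
      (T.card : ℝ) ≤ C * (√(nrm l) + √(nrmVec η) * √(nrm l) ^ 2) * nrm l ^ ε ∧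
      (T.card : ℝ) ≤ C * (1 + √(nrmVec η) * √(nrm l) ^ 3) * nrm l ^ ε := by
  obtain ⟨C₁, hC₁, hcop⟩ := exists_card_coplanar_le F hε
  obtain ⟨C₂, hC₂, hplane⟩ := exists_card_near_plane_le F hε
  set K₁ : ℝ := ∏ _σ : F →+* ℝ, 64 * K ^ 2 with hK₁
  set K₂ : ℝ := ∏ _σ : F →+* ℝ, (384 : ℝ) with hK₂
  have hK₁0 : 0 < K₁ := Finset.prod_pos fun _ _ => by positivity
  have hK₂1 : 1 ≤ K₂ := Finset.one_le_prod fun _ => by norm_num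
  refine ⟨K₁ * C₁ * (K₂ + 1) + C₂, by positivity, ?_⟩
  intro V _ _ Q hQ φ hφ l hl hlpos η hη T hT hnear f g hf hg u v hu hv e e' hee
  have hn := one_le_nrm hl
  have hX : 0 ≤ nrm l ^ ε := by positivity
  have hnl : nrm l = ∏ σ : F →+* ℝ, σ (l : F) := by
    rw [nrm_eq_prod]
    exact Finset.prod_congr rfl fun σ _ => abs_of_pos (hlpos σ)
  have hH : nrmVec η = ∏ σ, η σ :=
    Finset.prod_congr rfl fun σ _ => abs_of_pos (hη σ).1
  set a := √(nrm l) with ha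
  set h := √(nrmVec η) with hh
  have ha1 : 1 ≤ a := Real.one_le_sqrt.2 hn
  have hh0 : 0 < h := by
    rw [hh, hH]
    exact Real.sqrt_pos.2 (Finset.prod_pos fun σ _ => (hη σ).1)
  set A : (F →+* ℝ) → ℝ := fun σ => √(σ (l : F)) with hA
  set b : (F →+* ℝ) → ℝ := fun σ => √(η σ * σ (l : F)) with hb
  have hpA : ∏ σ, A σ = a := by
    rw [hA, prod_sqrt fun σ => (hlpos σ).le, ← hnl]
  have hpb : ∏ σ, b σ = h * a := by
    rw [hb, prod_sqrt fun σ => mul_nonneg (hη σ).1.le (hlpos σ).le, Finset.prod_mul_distrib, ← hnl,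
      ← hH, Real.sqrt_mul (by rw [hH]; exact Finset.prod_nonneg fun σ _ => (hη σ).1.le)]
  have hb0 : ∀ σ, 0 < b σ := fun σ => Real.sqrt_pos.2 (mul_pos (hη σ).1 (hlpos σ))
  have hbA : ∀ σ, b σ ≤ A σ := fun σ =>
    Real.sqrt_le_sqrt (mul_le_of_le_one_left (hlpos σ).le (hη σ).2)
  have E1 : (T.card : ℝ) ≤ K₁ * C₁ * (a + h * a ^ 2) * nrm l ^ ε := by
    have h1 := card_le_of_strip T hK hb0 hbA (by rw [hpA]; exact ha1) f g
      (fun y hy σ => Real.abs_le_sqrt (hf y hy σ)) (fun y hy σ => Real.abs_le_sqrt (hg y hy σ))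
      u v hu hv (B := C₁ * nrm l ^ ε) ?_
    · rw [← hK₁, hpA, hpb] at h1
      exact h1.trans_eq (by ring)
    · intro T' hT' huv
      refine hcop V Q hQ l hl T' (fun y hy => hT y (hT' hy)) fun y₀ h₀ y₁ h₁ y₂ h₂ y₃ h₃ => ?_
      have h4 : ∀ y ∈ T', ∃ a a' : 𝓞 F, y - y₀ = a • e + a' • e' := fun y hy =>
        hee _ (by rw [map_sub, (huv y hy y₀ h₀).1, sub_self])
          (by rw [map_sub, (huv y hy y₀ h₀).2, sub_self])
      obtain ⟨c₁, c₁', e₁⟩ := h4 y₁ h₁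
      obtain ⟨c₂, c₂', e₂⟩ := h4 y₂ h₂
      obtain ⟨c₃, c₃', e₃⟩ := h4 y₃ h₃
      rw [e₁, e₂, e₃]
      exact gram₃_eq_zero_of_plane Q e e' c₁ c₂ c₃ c₁' c₂' c₃'
  refine ⟨E1.trans ?_, ?_⟩
  · gcongr
    nlinarith [mul_pos hK₁0 hC₁]
  have ha23 : a ^ 2 ≤ a ^ 3 := pow_le_pow_right₀ ha1 (by norm_num)
  -- The condition says `K₂ h² a³ ≤ 1`, which lets plane cells be at least as thick as the
  -- neighbourhood. If it fails, then `1 ≤ K₂ h a²`, so `a ≤ K₂ h a³` and the strip bound implies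
  -- the plane bound.
  by_cases hcond : (∏ σ, b σ) * ∏ σ, 384 * (b σ * A σ) ≤ 1
  · have h2 := hplane V Q hQ φ hφ l hl b A hb0 hbA hcond T hT fun y hy σ => by
      have h3 : ∑ i, φ σ i y ^ 2 = σ (l : F) := by rw [← hφ σ y, hT y hy]
      rw [Fin.sum_univ_four] at h3
      have h4 := hnear y hy σ
      refine ⟨Real.abs_le_sqrt ?_, Real.abs_le_sqrt ?_, Real.abs_le_sqrt ?_, Real.abs_le_sqrt ?_⟩ <;>
      linarith [sq_nonneg (φ σ 0 y), sq_nonneg (φ σ 1 y), sq_nonneg (φ σ 2 y),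
        sq_nonneg (φ σ 3 y)]
    rw [Finset.prod_mul_distrib, hpA, hpb] at h2
    refine h2.trans ?_
    have : 1 + a * (h * a * a) = 1 + h * a ^ 3 := by ring
    rw [this]
    gcongr
    have : 0 < K₁ * C₁ * (K₂ + 1) := by positivity
    linarith
  · rw [not_le, Finset.prod_mul_distrib, Finset.prod_mul_distrib, ← hK₂, hpA, hpb] at hcond
    have h1 : 1 ≤ K₂ * (h * a ^ 2) := by
      by_contra hlt
      rw [not_le] at hlt
      have h2 : (K₂ * (h * a ^ 2)) ^ 2 ≤ 1 := pow_le_one₀ (by positivity) hlt.le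
      have h3 : h * a * (K₂ * (h * a * a)) ≤ (K₂ * (h * a ^ 2)) ^ 2 := by
        calc h * a * (K₂ * (h * a * a)) = h ^ 2 * a ^ 3 * 1 * K₂ := by ring
          _ ≤ h ^ 2 * a ^ 3 * (K₂ * a) * K₂ := by
            gcongr
            nlinarith
          _ = _ := by ring
      linarith
    have h2 : a ≤ K₂ * (h * a ^ 3) := by nlinarith
    have h3 : h * a ^ 2 ≤ h * a ^ 3 := by gcongr
    have h4 : a + h * a ^ 2 ≤ (K₂ + 1) * (1 + h * a ^ 3) := by nlinarith
    calc (T.card : ℝ) ≤ K₁ * C₁ * (a + h * a ^ 2) * nrm l ^ ε := E1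
      _ ≤ K₁ * C₁ * ((K₂ + 1) * (1 + h * a ^ 3)) * nrm l ^ ε := by gcongr
      _ = K₁ * C₁ * (K₂ + 1) * (1 + h * a ^ 3) * nrm l ^ ε := by ring
      _ ≤ _ := by
        gcongr
        linarith

end Combination

/-! ### The two counting problems -/

section Counting

variable {F : Type*} [Field F] {M : ℝ} {Qt : QuadraticForm (𝓞 F) (Fin 3 → 𝓞 F)}

/-- The zeroth coordinate at the embedding `σ`. -/
def headHom (σ : F →+* ℝ) : (Fin 4 → 𝓞 F) →+ ℝ :=
  AddMonoidHom.mk' (fun y => σ (y 0 : F)) fun y z => by simp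

/-- The component along `v` of the last three coordinates, in diagonalizing coordinates. -/
def Diagonalization.tailHom (D : Diagonalization M Qt) (σ : F →+* ℝ) (v : Fin 3 → ℝ) :
    (Fin 4 → 𝓞 F) →+ ℝ :=
  AddMonoidHom.mk' (fun y => ∑ k, D.L σ k (vecConj σ (Fin.tail y)) * v k) fun y z => by
    have h : vecConj σ (Fin.tail (y + z)) = vecConj σ (Fin.tail y) + vecConj σ (Fin.tail z) := by
      ext i
      simp [vecConj, Fin.tail]
    simp only [h, map_add, add_mul, Finset.sum_add_distrib]

lemma Diagonalization.bil_eq_tailHom (D : Diagonalization M Qt) (σ : F →+* ℝ) (x : Fin 3 → ℝ)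
    (y : Fin 4 → 𝓞 F) :
    bil Qt σ (vecConj σ (Fin.tail y)) x = D.tailHom σ (fun k => D.L σ k x) y :=
  D.bil_eq _ _ _

lemma Diagonalization.conj_eq (D : Diagonalization M Qt) (σ : F →+* ℝ) (x : Fin 3 → ℝ) :
    conj Qt σ x = ∑ k, D.L σ k x ^ 2 := by
  rw [conj, D.bil_eq]
  exact Finset.sum_congr rfl fun k _ => (sq _).symm

lemma Diagonalization.map_eq (D : Diagonalization M Qt) {Q : QuadraticForm (𝓞 F) (Fin 4 → 𝓞 F)}
    (hQ : ∀ y : Fin 4 → 𝓞 F, Q y = y 0 ^ 2 + Qt (Fin.tail y)) (σ : F →+* ℝ) (y : Fin 4 → 𝓞 F) :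
    σ (Q y : F) = headHom σ y ^ 2 + ∑ k, D.L σ k (vecConj σ (Fin.tail y)) ^ 2 := by
  rw [← D.conj_eq, conj_vecConj, hQ]
  simp [headHom]

/-- Rotating the diagonalizing coordinates so that the unit vector `x` is a coordinate vector. -/
lemma Diagonalization.exists_rotation (D : Diagonalization M Qt)
    {Q : QuadraticForm (𝓞 F) (Fin 4 → 𝓞 F)}
    (hQ : ∀ y : Fin 4 → 𝓞 F, Q y = y 0 ^ 2 + Qt (Fin.tail y)) (σ : F →+* ℝ) {x : Fin 3 → ℝ}
    (hx : conj Qt σ x = 1) : ∃ φ φ' : (Fin 4 → 𝓞 F) →+ ℝ,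
      (∀ y, conj Qt σ (vecConj σ (Fin.tail y)) =
        bil Qt σ (vecConj σ (Fin.tail y)) x ^ 2 + φ y ^ 2 + φ' y ^ 2) ∧
      IsFrame Q σ ![headHom σ, D.tailHom σ (fun k => D.L σ k x), φ, φ'] ∧
      IsFrame Q σ ![φ, φ', headHom σ, D.tailHom σ (fun k => D.L σ k x)] := by
  rw [D.conj_eq] at hx
  obtain ⟨a, b, hab⟩ := exists_orthonormal_extension hx
  have key : ∀ y, conj Qt σ (vecConj σ (Fin.tail y)) =
      bil Qt σ (vecConj σ (Fin.tail y)) x ^ 2 + D.tailHom σ a y ^ 2 + D.tailHom σ b y ^ 2 := by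
    intro y
    rw [D.conj_eq, hab, D.bil_eq]
    rfl
  refine ⟨D.tailHom σ a, D.tailHom σ b, key, fun y => ?_, fun y => ?_⟩ <;>
  · rw [D.map_eq hQ, ← D.conj_eq, key, D.bil_eq_tailHom, Fin.sum_univ_four]
    simp only [Matrix.cons_val_zero, Matrix.cons_val_one, Matrix.cons_val]
    ring

/-- Since `r² ≥ 1 / M`, a small diagonal coordinate forces a small integral one. The 2 leaves room
for a rotation of two coordinates, and `(2 M + 1)² ≥ 2 M`. -/
lemma Diagonalization.sq_le (D : Diagonalization M Qt) {σ : F →+* ℝ} {k : Fin 3} {t s : ℝ}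
    (h : (D.r σ k * t) ^ 2 ≤ 2 * s ^ 2) (hs : 0 ≤ s) : |t| ≤ (2 * |M| + 1) * s := by
  have h1 := D.one_le σ k
  have hM : 0 < M := by
    by_contra hM
    nlinarith [sq_nonneg (D.r σ k)]
  rw [abs_of_pos hM]
  refine abs_le_of_sq_le_sq ?_ (by positivity)
  have h2 : t ^ 2 ≤ M * (2 * s ^ 2) := by
    calc t ^ 2 ≤ M * D.r σ k ^ 2 * t ^ 2 := le_mul_of_one_le_left (sq_nonneg t) h1
      _ = M * (D.r σ k * t) ^ 2 := by ring
      _ ≤ _ := by gcongr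
  nlinarith [sq_nonneg s, mul_nonneg hM.le (sq_nonneg s), mul_nonneg (sq_nonneg M) (sq_nonneg s)]

lemma Diagonalization.L_two_sub (D : Diagonalization M Qt) (σ : F →+* ℝ) (y y' : Fin 4 → 𝓞 F) :
    D.L σ 2 (vecConj σ (Fin.tail y)) - D.L σ 2 (vecConj σ (Fin.tail y')) =
      D.r σ 2 * σ ((y 3 - y' 3 : 𝓞 F) : F) := by
  rw [D.L_two, D.L_two, ← mul_sub]
  simp only [map_sub]
  rfl

lemma Diagonalization.L_one_sub (D : Diagonalization M Qt) (σ : F →+* ℝ) {y y' : Fin 4 → 𝓞 F}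
    (h : y 3 = y' 3) :
    D.L σ 1 (vecConj σ (Fin.tail y)) - D.L σ 1 (vecConj σ (Fin.tail y')) =
      D.r σ 1 * σ ((y 2 - y' 2 : 𝓞 F) : F) := by
  rw [← map_sub, D.L_one]
  · simp only [map_sub]
    rfl
  · change σ (y 3 : F) - σ (y' 3 : F) = 0
    rw [h, sub_self]

/-- Both bounds for points near the plane orthogonal to `y₀` and `x`. -/
lemma exists_card_first_le (F : Type*) [Field F] [NumberField F] [IsTotallyReal F] {ε : ℝ}
    (M : ℝ) (hε : 0 < ε) : ∃ C : ℝ, 0 < C ∧ ∀ (Q : QuadraticForm (𝓞 F) (Fin 4 → 𝓞 F))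
      (Qt : QuadraticForm (𝓞 F) (Fin 3 → 𝓞 F)),
      (∀ y : Fin 4 → 𝓞 F, Q y = y 0 ^ 2 + Qt (Fin.tail y)) → TotPosDef Q →
      Diagonalization M Qt → ∀ l : 𝓞 F, l ≠ 0 → (∀ σ : F →+* ℝ, 0 < σ (l : F)) →
      ∀ η : (F →+* ℝ) → ℝ, (∀ σ, 0 < η σ ∧ η σ ≤ 1) →
      ∀ x : (F →+* ℝ) → Fin 3 → ℝ, (∀ σ, conj Qt σ (x σ) = 1) →
      ∀ T : Finset (Fin 4 → 𝓞 F), (∀ y ∈ T, Q y = l ∧ ∀ σ : F →+* ℝ,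
        σ (y 0 : F) ^ 2 + bil Qt σ (vecConj σ (Fin.tail y)) (x σ) ^ 2 ≤ η σ * σ (l : F)) →
      (T.card : ℝ) ≤ C * (√(nrm l) + √(nrmVec η) * √(nrm l) ^ 2) * nrm l ^ ε ∧
      (T.card : ℝ) ≤ C * (1 + √(nrmVec η) * √(nrm l) ^ 3) * nrm l ^ ε := by
  have hK : 1 ≤ 2 * |M| + 1 := by linarith [abs_nonneg M]
  obtain ⟨C, hC, hcount⟩ := exists_card_le_strip_and_plane F hε hK
  refine ⟨C, hC, fun Q Qt hQ hpos D l hl hlpos η hη x hx T hT => ?_⟩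
  choose φ φ' hφ hfr _ using fun σ => D.exists_rotation hQ σ (hx σ)
  -- The strip is that of `(y₃, y₀)`: `y₀` is short by hypothesis and `y₃` is read off from the last
  -- diagonal coordinate. Fixing both leaves a translate of the plane of `e₁, e₂`.
  refine hcount _ Q (embedding_map_pos hpos) _ hfr l hl hlpos η hη T (fun y hy => (hT y hy).1)
    (fun y hy σ => ?_) (fun σ y => D.L σ 2 (vecConj σ (Fin.tail y))) (fun σ => headHom σ)
    (fun y hy σ => ?_) (fun y hy σ => ?_) (Pi.evalAddMonoidHom _ 3) (Pi.evalAddMonoidHom _ 0)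
    (fun σ s y y' h1 _ => ?_) (fun σ s y y' _ h2 _ => ?_) (Pi.single 1 1) (Pi.single 2 1)
    fun y h3 h0 => ?_
  · have h1 := (hT y hy).2 σ
    rw [D.bil_eq_tailHom] at h1
    exact h1
  · have h1 := D.map_eq hQ σ y
    rw [(hT y hy).1, Fin.sum_univ_three] at h1
    rw [h1]
    nlinarith [sq_nonneg (headHom σ y), sq_nonneg (D.L σ 0 (vecConj σ (Fin.tail y))),
      sq_nonneg (D.L σ 1 (vecConj σ (Fin.tail y)))]
  · have h1 := (hT y hy).2 σ
    exact (le_add_of_nonneg_right (sq_nonneg _)).trans h1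
  · rw [D.L_two_sub] at h1
    have hs : 0 ≤ s := (abs_nonneg _).trans h1
    refine D.sq_le (σ := σ) (k := 2) ?_ hs
    have := sq_le_sq' (abs_le.1 h1).1 (abs_le.1 h1).2
    change (D.r σ 2 * σ ((y 3 - y' 3 : 𝓞 F) : F)) ^ 2 ≤ _
    nlinarith [sq_nonneg s]
  · have hs : 0 ≤ s := (abs_nonneg _).trans h2
    have h3 : |σ ((y 0 - y' 0 : 𝓞 F) : F)| ≤ s := by
      simp only [map_sub]
      exact h2
    exact h3.trans (le_mul_of_one_le_left hs hK)
  · refine ⟨y 1, y 2, ?_⟩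
    change y 3 = 0 at h3
    change y 0 = 0 at h0
    ext i
    fin_cases i <;> simp [h3, h0]

/-- Both bounds for points near the plane spanned by `y₀` and `x`. -/
lemma exists_card_second_le (F : Type*) [Field F] [NumberField F] [IsTotallyReal F] {ε : ℝ}
    (M : ℝ) (hε : 0 < ε) : ∃ C : ℝ, 0 < C ∧ ∀ (Q : QuadraticForm (𝓞 F) (Fin 4 → 𝓞 F))
      (Qt : QuadraticForm (𝓞 F) (Fin 3 → 𝓞 F)),
      (∀ y : Fin 4 → 𝓞 F, Q y = y 0 ^ 2 + Qt (Fin.tail y)) → TotPosDef Q →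
      Diagonalization M Qt → ∀ l : 𝓞 F, l ≠ 0 → (∀ σ : F →+* ℝ, 0 < σ (l : F)) →
      ∀ η : (F →+* ℝ) → ℝ, (∀ σ, 0 < η σ ∧ η σ ≤ 1) →
      ∀ x : (F →+* ℝ) → Fin 3 → ℝ, (∀ σ, conj Qt σ (x σ) = 1) →
      ∀ T : Finset (Fin 4 → 𝓞 F), (∀ y ∈ T, Q y = l ∧ ∀ σ : F →+* ℝ,
        conj Qt σ (vecConj σ (Fin.tail y)) - bil Qt σ (vecConj σ (Fin.tail y)) (x σ) ^ 2
          ≤ η σ * σ (l : F)) →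
      (T.card : ℝ) ≤ C * (√(nrm l) + √(nrmVec η) * √(nrm l) ^ 2) * nrm l ^ ε ∧
      (T.card : ℝ) ≤ C * (1 + √(nrmVec η) * √(nrm l) ^ 3) * nrm l ^ ε := by
  have hK : 1 ≤ 2 * |M| + 1 := by linarith [abs_nonneg M]
  obtain ⟨C, hC, hcount⟩ := exists_card_le_strip_and_plane F hε hK
  refine ⟨C, hC, fun Q Qt hQ hpos D l hl hlpos η hη x hx T hT => ?_⟩
  choose φ φ' hφ _ hfr using fun σ => D.exists_rotation hQ σ (hx σ)
  -- Here `ỹ` is close to the line of `x`, so its last two diagonal coordinates are close to the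
  -- line of those of `x`. Rotating that line to an axis gives the strip for `(y₃, y₂)`.
  choose p q hpq hperp using fun σ => exists_unit_normal (D.L σ 1 (x σ)) (D.L σ 2 (x σ))
  have hrot : ∀ (σ : F →+* ℝ) (s t₁ t₂ : ℝ), |p σ * t₁ + q σ * t₂| ≤ s → |p σ * t₂ - q σ * t₁| ≤ s →
      t₁ ^ 2 ≤ 2 * s ^ 2 ∧ t₂ ^ 2 ≤ 2 * s ^ 2 := by
    intro σ s t₁ t₂ h1 h2
    have h3 := sq_le_sq' (abs_le.1 h1).1 (abs_le.1 h1).2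
    have h4 := sq_le_sq' (abs_le.1 h2).1 (abs_le.1 h2).2
    have h5 : (p σ * t₁ + q σ * t₂) ^ 2 + (p σ * t₂ - q σ * t₁) ^ 2 = t₁ ^ 2 + t₂ ^ 2 := by
      linear_combination (t₁ ^ 2 + t₂ ^ 2) * hpq σ
    constructor <;> nlinarith [sq_nonneg t₁, sq_nonneg t₂]
  refine hcount _ Q (embedding_map_pos hpos) _ hfr l hl hlpos η hη T (fun y hy => (hT y hy).1)
    (fun y hy σ => ?_)
    (fun σ y => p σ * D.L σ 1 (vecConj σ (Fin.tail y)) + q σ * D.L σ 2 (vecConj σ (Fin.tail y)))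
    (fun σ y => p σ * D.L σ 2 (vecConj σ (Fin.tail y)) - q σ * D.L σ 1 (vecConj σ (Fin.tail y)))
    (fun y hy σ => ?_) (fun y hy σ => ?_) (Pi.evalAddMonoidHom _ 3) (Pi.evalAddMonoidHom _ 2)
    (fun σ s y y' h1 h2 => ?_) (fun σ s y y' h1 h2 h3 => ?_) (Pi.single 0 1) (Pi.single 1 1)
    fun y h3 h2 => ?_
  · have h1 := (hT y hy).2 σ
    rw [hφ σ y] at h1
    change φ σ y ^ 2 + φ' σ y ^ 2 ≤ _
    linarith
  · have h1 := D.map_eq hQ σ y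
    rw [(hT y hy).1, Fin.sum_univ_three] at h1
    rw [h1]
    set t₁ := D.L σ 1 (vecConj σ (Fin.tail y))
    set t₂ := D.L σ 2 (vecConj σ (Fin.tail y))
    have h5 : (p σ * t₁ + q σ * t₂) ^ 2 + (p σ * t₂ - q σ * t₁) ^ 2 = t₁ ^ 2 + t₂ ^ 2 := by
      linear_combination (t₁ ^ 2 + t₂ ^ 2) * hpq σ
    nlinarith [sq_nonneg (headHom σ y), sq_nonneg (D.L σ 0 (vecConj σ (Fin.tail y))),
      sq_nonneg (p σ * t₂ - q σ * t₁)]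
  · have h1 := (hT y hy).2 σ
    have h2 := hx σ
    rw [D.conj_eq, D.bil_eq] at h1
    rw [D.conj_eq] at h2
    simp only [Fin.sum_univ_three] at h1 h2
    refine le_trans ?_ h1
    have h3 := hperp σ
    have h4 := hpq σ
    generalize D.L σ 0 (vecConj σ (Fin.tail y)) = t₀
    generalize D.L σ 1 (vecConj σ (Fin.tail y)) = t₁
    generalize D.L σ 2 (vecConj σ (Fin.tail y)) = t₂
    generalize D.L σ 0 (x σ) = x₀ at *
    generalize D.L σ 1 (x σ) = x₁ at *
    generalize D.L σ 2 (x σ) = x₂ at *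
    set w := t₀ * x₀ + t₁ * x₁ + t₂ * x₂ with hw
    have h5 : t₀ ^ 2 + t₁ ^ 2 + t₂ ^ 2 - w ^ 2 =
        (t₀ - w * x₀) ^ 2 + (t₁ - w * x₁) ^ 2 + (t₂ - w * x₂) ^ 2 := by
      linear_combination (-w ^ 2) * h2 + 2 * w * hw
    -- `x` has no transverse component, so that of `ỹ` equals that of `ỹ - w x`, whose squared
    -- length is the quantity bounded by hypothesis.
    have h6 : p σ * t₂ - q σ * t₁ = p σ * (t₂ - w * x₂) - q σ * (t₁ - w * x₁) := by
      linear_combination w * h3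
    have h7 : (p σ * (t₂ - w * x₂) - q σ * (t₁ - w * x₁)) ^ 2 +
        (p σ * (t₁ - w * x₁) + q σ * (t₂ - w * x₂)) ^ 2 =
        (t₁ - w * x₁) ^ 2 + (t₂ - w * x₂) ^ 2 := by
      linear_combination ((t₁ - w * x₁) ^ 2 + (t₂ - w * x₂) ^ 2) * h4
    rw [h6, h5]
    nlinarith [sq_nonneg (t₀ - w * x₀), sq_nonneg (p σ * (t₁ - w * x₁) + q σ * (t₂ - w * x₂))]
  · have hs : 0 ≤ s := (abs_nonneg _).trans h1
    refine D.sq_le (σ := σ) (k := 2) ?_ hs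
    change (D.r σ 2 * σ ((y 3 - y' 3 : 𝓞 F) : F)) ^ 2 ≤ _
    rw [← D.L_two_sub]
    refine (hrot σ s (D.L σ 1 (vecConj σ (Fin.tail y)) - D.L σ 1 (vecConj σ (Fin.tail y'))) _
      ?_ ?_).2
    · convert h1 using 2
      ring
    · convert h2 using 2
      ring
  · have hs : 0 ≤ s := (abs_nonneg _).trans h1
    refine D.sq_le (σ := σ) (k := 1) ?_ hs
    change (D.r σ 1 * σ ((y 2 - y' 2 : 𝓞 F) : F)) ^ 2 ≤ _
    rw [← D.L_one_sub σ h3]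
    refine (hrot σ s _ (D.L σ 2 (vecConj σ (Fin.tail y)) - D.L σ 2 (vecConj σ (Fin.tail y')))
      ?_ ?_).1
    · convert h1 using 2
      ring
    · convert h2 using 2
      ring
  · refine ⟨y 0, y 1, ?_⟩
    change y 3 = 0 at h3
    change y 2 = 0 at h2
    ext i
    fin_cases i <;> simp [h3, h2]

end Counting

/-! ### Finiteness, exponents and the final constants -/

section Final

/-- An infinite set has finite subsets of every size, so a uniform bound for finite subsets also
gives finiteness. -/
lemma finite_and_ncard_le {α : Type*} {S : Set α} {B : ℝ}
    (h : ∀ T : Finset α, (∀ y ∈ T, y ∈ S) → (T.card : ℝ) ≤ B) :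
    S.Finite ∧ (S.ncard : ℝ) ≤ B := by
  have hfin : S.Finite := by
    by_contra hinf
    obtain ⟨T, hTS, hT⟩ := Set.Infinite.exists_subset_card_eq hinf (⌊B⌋₊ + 1)
    have h1 := h T fun y hy => hTS hy
    rw [hT] at h1
    push_cast at h1
    linarith [Nat.lt_floor_add_one B]
  refine ⟨hfin, ?_⟩
  rw [Set.ncard_eq_toFinset_card S hfin]
  exact h _ fun y hy => hfin.mem_toFinset.1 hy

lemma le_rpow_of_pow_le {x y : ℝ} (hx : 0 ≤ x) (hy : 0 ≤ y) (h : x ^ 11 ≤ y ^ 6) :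
    x ≤ y ^ (6 / 11 : ℝ) := by
  calc x = (x ^ 11) ^ (1 / 11 : ℝ) := by
        rw [← Real.rpow_natCast, ← Real.rpow_mul hx]
        norm_num
    _ ≤ (y ^ 6) ^ (1 / 11 : ℝ) := by gcongr
    _ = _ := by
        rw [← Real.rpow_natCast, ← Real.rpow_mul hy]
        norm_num

lemma min_bound_first {a h : ℝ} (hh : 0 ≤ h) {N B : ℝ} (hB : 0 ≤ B)
    (h1 : N ≤ (a + h * a ^ 2) * B) (h2 : N ≤ (1 + h * a ^ 3) * B) :
    N ≤ (h * a ^ 2 + 1 + min (a ^ 3 * h) a) * B := by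
  rcases le_total (a ^ 3 * h) a with hle | hle
  · rw [min_eq_left hle]
    refine h2.trans (mul_le_mul_of_nonneg_right ?_ hB)
    have : 0 ≤ h * a ^ 2 := by positivity
    linarith
  · rw [min_eq_right hle]
    exact h1.trans (mul_le_mul_of_nonneg_right (by linarith) hB)

/-- Split at `h a² = 1`: the strip bound is used above, the plane bound below. Each term is compared
with `(h a⁴)^(6/11)` through eleventh powers, using `h ≤ 1 ≤ a`. -/
lemma min_bound_second {a h : ℝ} (ha : 1 ≤ a) (hh : 0 ≤ h) (hh1 : h ≤ 1) {N B : ℝ} (hB : 0 ≤ B)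
    (h1 : N ≤ (a + h * a ^ 2) * B) (h2 : N ≤ (1 + h * a ^ 3) * B) :
    N ≤ 2 * (1 + min ((h * a ^ 4) ^ (6 / 11 : ℝ)) (a ^ 2)) * B := by
  have ha0 : 0 ≤ a := by linarith
  have haa : a ≤ a ^ 2 := by nlinarith
  set m := min ((h * a ^ 4) ^ (6 / 11 : ℝ)) (a ^ 2) with hm
  have hm0 : 0 ≤ m := by positivity
  rcases le_total 1 (h * a ^ 2) with hle | hle
  · refine h1.trans (mul_le_mul_of_nonneg_right ?_ hB)
    have e1 : a ≤ m := by
      refine le_min (le_rpow_of_pow_le ha0 (by positivity) ?_) haa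
      calc a ^ 11 ≤ a ^ 12 := pow_le_pow_right₀ ha (by norm_num)
        _ = (1 * a ^ 2) ^ 6 := by ring
        _ ≤ (h * a ^ 2 * a ^ 2) ^ 6 := by gcongr
        _ = _ := by ring
    have e2 : h * a ^ 2 ≤ m := by
      refine le_min (le_rpow_of_pow_le (by positivity) (by positivity) ?_)
        (mul_le_of_le_one_left (by positivity) hh1)
      calc (h * a ^ 2) ^ 11 = h ^ 11 * a ^ 22 := by ring
        _ ≤ h ^ 6 * a ^ 24 :=
          mul_le_mul (pow_le_pow_of_le_one hh hh1 (by norm_num))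
            (pow_le_pow_right₀ ha (by norm_num)) (by positivity) (by positivity)
        _ = _ := by ring
    linarith
  · refine h2.trans (mul_le_mul_of_nonneg_right ?_ hB)
    have e1 : h * a ^ 3 ≤ m := by
      refine le_min (le_rpow_of_pow_le (by positivity) (by positivity) ?_) ?_
      · calc (h * a ^ 3) ^ 11 = h ^ 6 * a ^ 23 * (h * a ^ 2) ^ 5 := by ring
          _ ≤ h ^ 6 * a ^ 23 * 1 := by
            gcongr
            exact pow_le_one₀ (by positivity) hle
          _ ≤ h ^ 6 * a ^ 24 := by
            rw [mul_one]
            gcongr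
            · norm_num
          _ = _ := by ring
      · calc h * a ^ 3 = h * a ^ 2 * a := by ring
          _ ≤ 1 * a := by gcongr
          _ ≤ _ := by linarith
    linarith

/-- `N(l) ≤ |l|_∞ ^ d`, so an exponent `ε / d` on the norm suffices; the factor `X ≥ 1` is for the
discriminant. -/
lemma nrm_rpow_le_supAbs_rpow {F : Type*} [Field F] [NumberField F] [IsTotallyReal F] {l : 𝓞 F}
    (hl : l ≠ 0) {X ε : ℝ} (hX : 1 ≤ X) (hε : 0 < ε) :
    nrm l ^ (ε / Fintype.card (F →+* ℝ)) ≤ (supAbs l * X) ^ ε := by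
  have hn := one_le_nrm hl
  have hle : ∀ σ : F →+* ℝ, |σ (l : F)| ≤ supAbs l := fun σ =>
    le_ciSup (f := fun σ : F →+* ℝ => |σ (l : F)|) (Set.finite_range _).bddAbove σ
  have hs0 : 0 ≤ supAbs l := (abs_nonneg _).trans (hle (Classical.arbitrary _))
  have hpow : nrm l ≤ supAbs l ^ Fintype.card (F →+* ℝ) := by
    rw [nrm_eq_prod, ← Finset.card_univ, ← Finset.prod_const]
    exact Finset.prod_le_prod (fun _ _ => abs_nonneg _) fun σ _ => hle σ
  have hd : (Fintype.card (F →+* ℝ) : ℝ) ≠ 0 := by exact_mod_cast Fintype.card_ne_zero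
  calc nrm l ^ (ε / Fintype.card (F →+* ℝ)) ≤
      (supAbs l ^ Fintype.card (F →+* ℝ)) ^ (ε / Fintype.card (F →+* ℝ)) := by gcongr
    _ = supAbs l ^ ε := by
      rw [← Real.rpow_natCast, ← Real.rpow_mul hs0, mul_div_cancel₀ _ hd]
    _ ≤ _ := by
      gcongr
      exact le_mul_of_one_le_right hs0 hX

end Final

end QuatCount

end

theorem lemma4p4 (F : Type*) [Field F] [NumberField F] [NumberField.IsTotallyReal F]
    (M ε : ℝ) (hε : 0 < ε) :
    ∃ C : ℝ, 0 < C ∧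
      ∀ (Q : QuadraticForm (𝓞 F) (Fin 4 → 𝓞 F)) (Qt : QuadraticForm (𝓞 F) (Fin 3 → 𝓞 F)),
        (∀ y : Fin 4 → 𝓞 F, Q y = y 0 ^ 2 + Qt (Fin.tail y)) →
        QuatCount.TotPosDef Q →
        QuatCount.IsReduced M Qt →
        ∀ l : 𝓞 F, l ≠ 0 → (∀ σ : F →+* ℝ, 0 < σ (l : F)) →
        ∀ η : (F →+* ℝ) → ℝ, (∀ σ, 0 < η σ ∧ η σ ≤ 1) →
        ∀ x : (F →+* ℝ) → Fin 3 → ℝ, (∀ σ, QuatCount.conj Qt σ (x σ) = 1) →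
        ({y : Fin 4 → 𝓞 F | Q y = l ∧ ∀ σ : F →+* ℝ,
            σ (y 0 : F) ^ 2 + QuatCount.bil Qt σ (QuatCount.vecConj σ (Fin.tail y)) (x σ) ^ 2
              ≤ η σ * σ (l : F)}.Finite ∧
          (({y : Fin 4 → 𝓞 F | Q y = l ∧ ∀ σ : F →+* ℝ,
            σ (y 0 : F) ^ 2 + QuatCount.bil Qt σ (QuatCount.vecConj σ (Fin.tail y)) (x σ) ^ 2
              ≤ η σ * σ (l : F)}.ncard : ℕ) : ℝ) ≤
            C * (QuatCount.nrmVec η ^ (1 / 2 : ℝ) * QuatCount.nrm l + 1 +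
                min (QuatCount.nrm l ^ (3 / 2 : ℝ) * QuatCount.nrmVec η ^ (1 / 2 : ℝ))
                  (QuatCount.nrm l ^ (1 / 2 : ℝ))) *
              (QuatCount.supAbs l * QuatCount.nrm (QuatCount.disc Q)) ^ ε) ∧
        ({y : Fin 4 → 𝓞 F | Q y = l ∧ ∀ σ : F →+* ℝ,
            QuatCount.conj Qt σ (QuatCount.vecConj σ (Fin.tail y)) -
              QuatCount.bil Qt σ (QuatCount.vecConj σ (Fin.tail y)) (x σ) ^ 2
              ≤ η σ * σ (l : F)}.Finite ∧
          (({y : Fin 4 → 𝓞 F | Q y = l ∧ ∀ σ : F →+* ℝ,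
            QuatCount.conj Qt σ (QuatCount.vecConj σ (Fin.tail y)) -
              QuatCount.bil Qt σ (QuatCount.vecConj σ (Fin.tail y)) (x σ) ^ 2
              ≤ η σ * σ (l : F)}.ncard : ℕ) : ℝ) ≤
            C * (1 + min (QuatCount.nrmVec η ^ (3 / 11 : ℝ) * QuatCount.nrm l ^ (12 / 11 : ℝ))
                (QuatCount.nrm l)) *
              (QuatCount.supAbs l * QuatCount.nrm (QuatCount.disc Q)) ^ ε) := by
  have hd : (0 : ℝ) < Fintype.card (F →+* ℝ) := by exact_mod_cast Fintype.card_pos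
  obtain ⟨C₁, hC₁, hfirst⟩ := QuatCount.exists_card_first_le F M (div_pos hε hd)
  obtain ⟨C₂, hC₂, hsecond⟩ := QuatCount.exists_card_second_le F M (div_pos hε hd)
  -- The 2 is the loss in `min_bound_second`.
  refine ⟨C₁ + 2 * C₂, by positivity, fun Q Qt hQ hpos hred l hl hlpos η hη x hx => ?_⟩
  obtain ⟨D⟩ := hred.diagonalization (QuatCount.TotPosDef.of_tail hQ hpos)
  have hn := QuatCount.one_le_nrm hl
  have hX := QuatCount.nrm_rpow_le_supAbs_rpow hl
    (QuatCount.one_le_nrm (QuatCount.disc_ne_zero hpos)) hε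
  have hX0 : 0 ≤ QuatCount.nrm l ^ (ε / Fintype.card (F →+* ℝ)) := by positivity
  have hH0 : 0 ≤ QuatCount.nrmVec η := Finset.prod_nonneg fun _ _ => abs_nonneg _
  have hH1 : QuatCount.nrmVec η ≤ 1 :=
    Finset.prod_le_one (fun _ _ => abs_nonneg _) fun σ _ => by
      rw [abs_of_pos (hη σ).1]
      exact (hη σ).2
  set n := QuatCount.nrm l
  set H := QuatCount.nrmVec η
  set X := (QuatCount.supAbs l * QuatCount.nrm (QuatCount.disc Q)) ^ ε
  set X' := n ^ (ε / Fintype.card (F →+* ℝ))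
  have hn0 : 0 ≤ n := zero_le_one.trans hn
  have ha1 : 1 ≤ √n := Real.one_le_sqrt.2 hn
  have ha2 : √n ^ 2 = n := Real.sq_sqrt hn0
  have hh1 : √H ≤ 1 := Real.sqrt_le_one.2 hH1
  have e1 : H ^ (1 / 2 : ℝ) = √H := (Real.sqrt_eq_rpow H).symm
  have e2 : n ^ (1 / 2 : ℝ) = √n := (Real.sqrt_eq_rpow n).symm
  have e3 : n ^ (3 / 2 : ℝ) = √n ^ 3 := by
    rw [Real.sqrt_eq_rpow, ← Real.rpow_natCast, ← Real.rpow_mul hn0]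
    norm_num
  have e4 : H ^ (3 / 11 : ℝ) * n ^ (12 / 11 : ℝ) = (√H * √n ^ 4) ^ (6 / 11 : ℝ) := by
    rw [Real.mul_rpow (Real.sqrt_nonneg _) (by positivity), ← Real.rpow_natCast,
      Real.sqrt_eq_rpow, Real.sqrt_eq_rpow, ← Real.rpow_mul hH0, ← Real.rpow_mul hn0,
      ← Real.rpow_mul hn0]
    norm_num
  rw [e1, e2, e3, e4]
  have hm1 : 0 ≤ √H * n + 1 + min (√n ^ 3 * √H) √n := by positivity
  have hm2 : 0 ≤ 1 + min ((√H * √n ^ 4) ^ (6 / 11 : ℝ)) n := by positivity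
  constructor
  · refine QuatCount.finite_and_ncard_le fun T hT => ?_
    obtain ⟨b1, b2⟩ : (T.card : ℝ) ≤ C₁ * (√n + √H * √n ^ 2) * X' ∧
        (T.card : ℝ) ≤ C₁ * (1 + √H * √n ^ 3) * X' :=
      hfirst Q Qt hQ hpos D l hl hlpos η hη x hx T hT
    have b3 := QuatCount.min_bound_first (a := √n) (Real.sqrt_nonneg H) (B := C₁ * X')
      (by positivity) (b1.trans_eq (by ring)) (b2.trans_eq (by ring))
    rw [ha2] at b3
    calc (T.card : ℝ) ≤ C₁ * (√H * n + 1 + min (√n ^ 3 * √H) √n) * X' := b3.trans_eq (by ring)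
      _ ≤ _ := by
        gcongr
        linarith
  · refine QuatCount.finite_and_ncard_le fun T hT => ?_
    obtain ⟨b1, b2⟩ : (T.card : ℝ) ≤ C₂ * (√n + √H * √n ^ 2) * X' ∧
        (T.card : ℝ) ≤ C₂ * (1 + √H * √n ^ 3) * X' :=
      hsecond Q Qt hQ hpos D l hl hlpos η hη x hx T hT
    have b3 := QuatCount.min_bound_second ha1 (Real.sqrt_nonneg H) hh1 (B := C₂ * X')
      (by positivity) (b1.trans_eq (by ring)) (b2.trans_eq (by ring))
    rw [ha2] at b3
    calc (T.card : ℝ) ≤ 2 * C₂ * (1 + min ((√H * √n ^ 4) ^ (6 / 11 : ℝ)) n) * X' :=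
          b3.trans_eq (by ring)
      _ ≤ _ := by
        gcongr
        linarith
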